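/- **Conventions.** For an entire function $f(z)=\sum_{j\ge 0}a_jz^j$, $f\not\equiv 0$, its order is $\rho(f)=\limsup_{j\to\infty}\frac{j\log j}{\log(1/|a_j|)}$ (terms with $a_j=0$ count as $0$), and $f$ is said to be of genus zero if $\rho(f)<1$. All zeros are counted with multiplicity. Put $$C(f,R)=\exp\Big\{\frac1{2\pi}\int_0^{2\pi}\log|f(Re^{it})|\,dt\Big\},$$ let $\eta(f,R)$ be the number of zeros of $f$ in $0<|z|\le R$, and, for $f$ of genus zero with a zero of multiplicity $\alpha\ge 0$ at the origin and nonzero zeros $(z_j)$, let $$d^*(f)=\alpha+\#\{j:|z_j|\le 1\}+\sum_{|z_j|>1}\frac1{|z_j|}.$$ **Theorem.** Let $(P_n)$ be a sequence of entire functions of genus zero, none identically zero, let $(z_{n,j})_j$ be the nonzero zeros of $P_n$, and let $(k_n)$ be a sequence of positive real numbers. Assume that $$C_0^*:=\liminf_{n\to\infty}C(P_n,1)^{1/k_n}>0\qquad\text{and}\qquad \limsup_{n\to\infty}|P_n(z)|^{1/k_n}\le 1\quad\text{for every }z\in\mathbb C.$$ (It is not assumed that $k_n\ge d^*(P_n)$.)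 Then all the sums over zeros below converge absolutely, and exactly one of the following two alternatives holds: 1. for every integer $m\ge 1$, $$\lim_{R\to\infty}\limsup_{n\to\infty}\frac1{k_n}\sum_{|z_{n,j}|\ge R}\frac1{|z_{n,j}|^m}=\infty;$$ 2. there is an integer $m\ge 1$ with $$\lim_{R\to\infty}\limsup_{n\to\infty}\frac1{k_n}\sum_{|z_{n,j}|\ge R}\frac1{|z_{n,j}|^m}=0,\qquad(\ast)$$ and for every integer $l\ge 1$ $$\lim_{R\to\infty}\limsup_{n\to\infty}\frac1{k_n}\Big|\sum_{|z_{n,j}|\ge R}\frac1{z_{n,j}^l}\Big|=0.\qquad(\ast\ast)$$ Moreover, $(\ast)$ for a single $m\ge1$ already implies $(\ast\ast)$ for every $l\ge 1$. In particular, if $k_n\ge d^*(P_n)$ for all $n$, then alternative 2 holds, and hence $$\lim_{R\to\infty}\limsup_{n\to\infty}\frac1{k_n}\Big|\sum_{|z_{n,j}|\ge R}\frac1{z_{n,j}}\Big|=0,$$ and there is a sequence $(R_n)$ of positive real numbers tending to $\infty$ with $$\limsup_{n\to\infty}\frac{\eta(P_n,R_n)}{k_n}<\infty.$$ -/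

import Mathlib

open Filter Topology
open scoped ENNReal

noncomputable section

namespace GenusZero

/-- The `j`-th Taylor coefficient of `f` at the origin. -/
def taylorCoeff (f : ℂ → ℂ) (j : ℕ) : ℂ :=
  iteratedDeriv j f 0 / (j.factorial : ℂ)

/-- The order `limsup_j (j log j) / log (1 / |a_j|)` of the entire function `∑ a_j z ^ j`.
The quotient is read as `0` when `a_j = 0`; for an entire function `|a_j| < 1` for all large `j`. -/
def order (f : ℂ → ℂ) : EReal :=
  limsup (fun j : ℕ =>
    (((j : ℝ) * Real.log j / Real.log (1 / ‖taylorCoeff f j‖) : ℝ) : EReal)) atTop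

/-- An entire function, not identically zero, of order less than one. -/
structure IsGenusZero (f : ℂ → ℂ) : Prop where
  entire : Differentiable ℂ f
  ne_zero : f ≠ 0
  order_lt_one : order f < 1

/-- The multiplicity of `w` as a zero of `f` (it is `0` if `f w ≠ 0`). -/
def mult (f : ℂ → ℂ) (w : ℂ) : ℕ := analyticOrderNatAt f w

/-- `C(f, R) = exp ((1 / 2π) ∫_0^{2π} log |f (R e^{it})| dt)`. -/
def logMean (f : ℂ → ℂ) (R : ℝ) : ℝ :=
  Real.exp ((1 / (2 * Real.pi)) *
    ∫ t in (0 : ℝ)..(2 * Real.pi), Real.log ‖f (R * Complex.exp (t * Complex.I))‖)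

/-- The number of zeros of `f` in `0 < |z| ≤ R`, counted with multiplicity. -/
def zeroCount (f : ℂ → ℂ) (R : ℝ) : ℝ≥0∞ :=
  ∑' w : {w : ℂ // 0 < ‖w‖ ∧ ‖w‖ ≤ R}, (mult f w : ℝ≥0∞)

/-- The sum of `1 / |z_j| ^ m` over the nonzero zeros `z_j` of `f` with `|z_j| ≥ R`, repeated
according to multiplicity. -/
def absTail (f : ℂ → ℂ) (m : ℕ) (R : ℝ) : ℝ≥0∞ :=
  ∑' w : {w : ℂ // w ≠ 0 ∧ R ≤ ‖w‖}, ENNReal.ofReal ((mult f w : ℝ) / ‖(w : ℂ)‖ ^ m)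

/-- The sum of `1 / z_j ^ l` over the nonzero zeros `z_j` of `f` with `|z_j| ≥ R`, repeated
according to multiplicity. -/
def signedTail (f : ℂ → ℂ) (l : ℕ) (R : ℝ) : ℂ :=
  ∑' w : {w : ℂ // w ≠ 0 ∧ R ≤ ‖w‖}, (mult f w : ℂ) / (w : ℂ) ^ l

/-- The degree `d^*(f)` of a function of genus zero: the multiplicity of the zero at the origin,
plus the number of zeros in `0 < |z| ≤ 1`, plus the sum of `1 / |z_j|` over the zeros with
`|z_j| > 1`. -/
def degree (f : ℂ → ℂ) : ℝ≥0∞ :=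
  (mult f 0 : ℝ≥0∞) + zeroCount f 1 +
    ∑' w : {w : ℂ // 1 < ‖w‖}, ENNReal.ofReal ((mult f w : ℝ) / ‖(w : ℂ)‖)

/-- `C_0^* = liminf_n C(P_n, 1) ^ (1 / k_n)`, as an element of `[0, ∞]`. -/
def lowerConst (P : ℕ → ℂ → ℂ) (k : ℕ → ℝ) : ℝ≥0∞ :=
  liminf (fun n => ENNReal.ofReal (logMean (P n) 1 ^ (1 / k n))) atTop

/-- `limsup_n (1 / k_n) ∑_{|z_{n,j}| ≥ R} 1 / |z_{n,j}| ^ m`, as an element of `[0, ∞]`. -/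
def absTailLimsup (P : ℕ → ℂ → ℂ) (k : ℕ → ℝ) (m : ℕ) (R : ℝ) : ℝ≥0∞ :=
  limsup (fun n => absTail (P n) m R / ENNReal.ofReal (k n)) atTop

/-- `limsup_n (1 / k_n) |∑_{|z_{n,j}| ≥ R} 1 / z_{n,j} ^ l|`, as an element of `[0, ∞]`. -/
def signedTailLimsup (P : ℕ → ℂ → ℂ) (k : ℕ → ℝ) (l : ℕ) (R : ℝ) : ℝ≥0∞ :=
  limsup (fun n => ENNReal.ofReal (‖signedTail (P n) l R‖ / k n)) atTop

end GenusZero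

end

/-!
The counting function and the Fourier coefficients of `log |f|` on circles carry the proof; neither
a product expansion nor a compactness theorem for subharmonic functions is needed.

For entire `f`, the Fourier coefficients of `log |f|` on two circles free of zeros, of radii
`r < R`, determine each other up to explicit sums over the zeros (`circleCoeff_log_two_radii`), and
the coefficient of index `l ≥ 1` on the larger circle enters with the weight `(r / R) ^ l`. If `f`
has order less than one, that contribution vanishes as `R` tends to infinity, and the coefficient
on the smaller circle becomes
`-(1 / 2l) * (∑_{|w| < r} (conj w / r) ^ l + r ^ l * ∑_{|w| ≥ r} w⁻¹ ^ l)`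
(`IsGenusZero.circleCoeff_log`). So a signed tail is bounded by the `L¹` norm of `log |f|` on the
circle plus the number of zeros inside, divided by `r ^ l`. Jensen's formula (`zeroNum_mul_log_le`)
bounds that number by `L¹` norms as well. Everything therefore follows once the `L¹` norms of
`log |P n|` on large circles are known to be eventually at most a constant, independent of the
radius, times `k n`.

This is `eventually_circleAverage_abs_le`. If the absolute tails of one exponent `m` are `O(k n)`,
then the Fourier coefficients of index at least `m` are controlled by the zeros and those of
smaller index by the `L¹` norm, so that by Parseval's identity the `L²` norm of `log |P n|` is
bounded by a multiple of its `L¹` norm up to `O(k n)` (`IsGenusZero.sqrt_circleAverage_sq_le`).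
After division by the larger of the `L²` norm and `k n`, the functions are bounded in `L²` and
their limit superior is at most zero pointwise, hence their positive parts tend to zero in `L¹`.
The mean over the circle is bounded below by the mean over the unit circle, so the negative parts
are `O(k n)` up to the positive parts. Hence the `L²` norms are `O(k n)`, and then the positive
parts are `o(k n)`.

The dichotomy itself is elementary: if some absolute tail of exponent `m` has a finite limit
superior, then those of exponent `m + 1` are smaller by a factor `R⁻¹`, and otherwise all are
infinite. If `k n` dominates the degree, the tails of exponent one are at most `k n`.
-/

open Filter Topology
open scoped ENNReal

noncomputable section

namespace GenusZero

open Metric Real ComplexConjugate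

/-! ### Zeros of entire functions and Jensen's formula -/

lemma analyticOrderAt_ne_top_of_entire {f : ℂ → ℂ} (hf : Differentiable ℂ f) (h0 : f ≠ 0) (w : ℂ) :
    analyticOrderAt f w ≠ ⊤ := by
  intro h
  apply h0
  have hA : AnalyticOnNhd ℂ f Set.univ := fun z _ => hf.analyticAt z
  have := hA.eqOn_zero_of_preconnected_of_eventuallyEq_zero isPreconnected_univ (Set.mem_univ w)
    (analyticOrderAt_eq_top.1 h)
  funext z
  exact this (Set.mem_univ z)

lemma mult_ne_zero_iff {f : ℂ → ℂ} (hf : Differentiable ℂ f) (h0 : f ≠ 0) (w : ℂ) :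
    mult f w ≠ 0 ↔ f w = 0 := by
  rw [← (hf.analyticAt w).analyticOrderAt_ne_zero, mult,
    ← Nat.cast_analyticOrderNatAt (analyticOrderAt_ne_top_of_entire hf h0 w)]
  simp

lemma finite_zeros {f : ℂ → ℂ} (hf : Differentiable ℂ f) (h0 : f ≠ 0) (R : ℝ) :
    {w : ℂ | ‖w‖ ≤ R ∧ f w = 0}.Finite := by
  by_contra hinf
  obtain ⟨x, -, hx⟩ := Set.Infinite.exists_accPt_of_subset_isCompact hinf
    (isCompact_closedBall (0 : ℂ) R) (fun w hw => by simpa using hw.1)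
  have hA : AnalyticOnNhd ℂ f Set.univ := fun z _ => hf.analyticAt z
  have hfr : ∃ᶠ z in 𝓝[≠] x, f z = 0 :=
    (accPt_iff_frequently_nhdsNE.1 hx).mono fun z hz => hz.2
  have := hA.eqOn_zero_of_preconnected_of_frequently_eq_zero isPreconnected_univ
    (Set.mem_univ x) hfr
  exact h0 (funext fun z => this (Set.mem_univ z))

open Classical in
/-- The set of zeros of `f` in the closed disc of radius `R`. It is empty by convention if there
are infinitely many, which never happens for an entire function that is not identically zero. -/
def zeroFinset (f : ℂ → ℂ) (R : ℝ) : Finset ℂ :=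
  if h : {w : ℂ | ‖w‖ ≤ R ∧ f w = 0}.Finite then h.toFinset else ∅

lemma mem_zeroFinset {f : ℂ → ℂ} (hf : Differentiable ℂ f) (h0 : f ≠ 0) {R : ℝ} {w : ℂ} :
    w ∈ zeroFinset f R ↔ ‖w‖ ≤ R ∧ f w = 0 := by
  rw [zeroFinset, dif_pos (finite_zeros hf h0 R)]
  simp

/-- The number of zeros of `f` in the closed disc of radius `R`, with multiplicity; a zero at the
origin counts. -/
def zeroNum (f : ℂ → ℂ) (R : ℝ) : ℝ := ∑ w ∈ zeroFinset f R, (mult f w : ℝ)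

lemma zeroNum_nonneg (f : ℂ → ℂ) (R : ℝ) : 0 ≤ zeroNum f R :=
  Finset.sum_nonneg fun _ _ => Nat.cast_nonneg _

lemma exists_factor_at {f : ℂ → ℂ} (hf : Differentiable ℂ f) {w : ℂ}
    (h : analyticOrderAt f w ≠ ⊤) :
    ∃ g : ℂ → ℂ, Differentiable ℂ g ∧ g w ≠ 0 ∧ ∀ z, f z = (z - w) ^ mult f w * g z := by
  classical
  obtain ⟨g, hg, hgw, hfg⟩ := (hf.analyticAt w).analyticOrderAt_ne_top.1 h
  have key : ∀ z, f z = (z - w) ^ mult f w *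
      (if z = w then g w else f z / (z - w) ^ mult f w) := by
    intro z
    by_cases hz : z = w
    · subst hz; simpa [mult] using hfg.self_of_nhds
    · rw [if_neg hz, mul_div_cancel₀]
      exact pow_ne_zero _ (sub_ne_zero.2 hz)
  refine ⟨_, ?_, by simpa using hgw, key⟩
  intro z
  by_cases hz : z = w
  · subst hz
    refine hg.differentiableAt.congr_of_eventuallyEq ?_
    filter_upwards [hfg] with x hx
    by_cases hxz : x = z
    · simp [hxz]
    · rw [if_neg hxz, hx, smul_eq_mul, mult, mul_div_cancel_left₀]
      exact pow_ne_zero _ (sub_ne_zero.2 hxz)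
  · have : DifferentiableAt ℂ (fun z => f z / (z - w) ^ mult f w) z :=
      (hf z).div (by fun_prop) (pow_ne_zero _ (sub_ne_zero.2 hz))
    refine this.congr_of_eventuallyEq ?_
    filter_upwards [isOpen_ne.mem_nhds hz] with x hx
    rw [if_neg hx]

lemma exists_factorization_finset {f : ℂ → ℂ} (hf : Differentiable ℂ f) (h0 : f ≠ 0)
    (S : Finset ℂ) :
    ∃ g : ℂ → ℂ, Differentiable ℂ g ∧ (∀ w ∈ S, g w ≠ 0) ∧
      ∀ z, f z = (∏ w ∈ S, (z - w) ^ mult f w) * g z := by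
  classical
  induction S using Finset.induction_on with
  | empty => exact ⟨f, hf, by simp, by simp⟩
  | insert a S ha ih =>
    obtain ⟨g, hg, hgS, hfg⟩ := ih
    have hg0 : g ≠ 0 := fun h => h0 (funext fun z => by rw [hfg z, h]; simp)
    have hm : mult g a = mult f a := by
      have hprod : AnalyticAt ℂ (fun z => ∏ w ∈ S, (z - w) ^ mult f w) a := by fun_prop
      have : f = (fun z => ∏ w ∈ S, (z - w) ^ mult f w) * g := funext hfg
      unfold mult analyticOrderNatAt
      conv_rhs => rw [this, analyticOrderAt_mul hprod (hg.analyticAt a)]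
      rw [hprod.analyticOrderAt_eq_zero.2, zero_add]
      refine Finset.prod_ne_zero_iff.2 fun w hw => pow_ne_zero _ (sub_ne_zero.2 ?_)
      rintro rfl
      exact ha hw
    obtain ⟨q, hq, hqa, hgq⟩ := exists_factor_at hg (analyticOrderAt_ne_top_of_entire hg hg0 a)
    refine ⟨q, hq, ?_, fun z => ?_⟩
    · intro w hw
      rcases Finset.mem_insert.1 hw with rfl | hw
      · exact hqa
      · intro h
        exact hgS w hw (by rw [hgq w, h, mul_zero])
    · rw [hfg z, hgq z, hm, Finset.prod_insert ha]
      ring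

/-- An entire function is, on a given disc, the product of the linear factors belonging to its
zeros there and of an entire function without zeros in the disc. -/
lemma exists_factorization {f : ℂ → ℂ} (hf : Differentiable ℂ f) (h0 : f ≠ 0) (R : ℝ) :
    ∃ g : ℂ → ℂ, Differentiable ℂ g ∧ (∀ z, ‖z‖ ≤ R → g z ≠ 0) ∧
      ∀ z, f z = (∏ w ∈ zeroFinset f R, (z - w) ^ mult f w) * g z := by
  obtain ⟨g, hg, hgS, hfg⟩ := exists_factorization_finset hf h0 (zeroFinset f R)
  refine ⟨g, hg, fun z hz h => ?_, hfg⟩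
  exact hgS z ((mem_zeroFinset hf h0).2 ⟨hz, by rw [hfg z, h, mul_zero]⟩) h

lemma log_norm_factorization {f g : ℂ → ℂ} {S : Finset ℂ}
    (hfg : ∀ z, f z = (∏ w ∈ S, (z - w) ^ mult f w) * g z) {z : ℂ} (hz : f z ≠ 0) :
    log ‖f z‖ = ∑ w ∈ S, (mult f w : ℝ) * log ‖z - w‖ + log ‖g z‖ := by
  have h := hz
  rw [hfg z] at h
  rw [hfg z, norm_mul, log_mul (norm_ne_zero_iff.2 (left_ne_zero_of_mul h))
    (norm_ne_zero_iff.2 (right_ne_zero_of_mul h)), norm_prod, log_prod]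
  · simp
  · intro w hw
    exact norm_ne_zero_iff.2 (Finset.prod_ne_zero_iff.1 (left_ne_zero_of_mul h) w hw)

lemma circleIntegrable_log {f : ℂ → ℂ} (hf : Differentiable ℂ f) (r : ℝ) :
    CircleIntegrable (fun z => log ‖f z‖) 0 r :=
  MeromorphicOn.circleIntegrable_log_norm fun z _ => (hf.analyticAt z).meromorphicAt

/-- The mean of `log |f|` over the circle of radius `r` around the origin. -/
def circleMean (f : ℂ → ℂ) (r : ℝ) : ℝ := circleAverage (fun z => log ‖f z‖) 0 r

lemma circleMean_eq {f g : ℂ → ℂ} (hf : Differentiable ℂ f) (h0 : f ≠ 0) {r R : ℝ} (hr : 0 < r)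
    (hrR : r ≤ R) (hg : Differentiable ℂ g) (hgR : ∀ z, ‖z‖ ≤ R → g z ≠ 0)
    (hfg : ∀ z, f z = (∏ w ∈ zeroFinset f R, (z - w) ^ mult f w) * g z) :
    circleMean f r = ∑ w ∈ zeroFinset f R, (mult f w : ℝ) * (log r + posLog (r⁻¹ * ‖w‖)) +
      log ‖g 0‖ := by
  have hcongr : (fun z => log ‖f z‖) =ᶠ[codiscreteWithin (sphere (0 : ℂ) |r|)]
      (fun z => ∑ w ∈ zeroFinset f R, (mult f w : ℝ) * log ‖z - w‖) + fun z => log ‖g z‖ := by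
    have : {z | f z ≠ 0} ∈ codiscreteWithin (sphere (0 : ℂ) |r|) := by
      apply codiscreteWithin_iff_locallyFiniteComplementWithin.2
      intro z hz
      refine ⟨Set.univ, Filter.univ_mem, ((finite_zeros hf h0 r).subset ?_)⟩
      rintro w ⟨-, hw, hw'⟩
      simp only [abs_of_pos hr, mem_sphere_iff_norm, sub_zero] at hw
      exact ⟨hw.le, by simpa using hw'⟩
    filter_upwards [this] with z hz
    exact log_norm_factorization hfg hz
  rw [circleMean, circleAverage_congr_codiscreteWithin hcongr hr.ne',
    circleAverage_add _ (circleIntegrable_log hg r)]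
  · congr 1
    · rw [circleAverage_fun_sum]
      · refine Finset.sum_congr rfl fun w _ => ?_
        simp_rw [← smul_eq_mul, circleAverage_fun_smul]
        rw [circleAverage_log_norm_sub_const_eq_log_radius_add_posLog hr.ne', zero_sub, norm_neg]
        simp only [smul_eq_mul]
      · intro w _
        exact (circleIntegrable_log_norm_sub_const r).const_mul _
    · refine AnalyticOnNhd.circleAverage_log_norm_of_ne_zero (fun z _ => hg.analyticAt z)
        fun u hu => hgR u ?_
      rw [abs_of_pos hr] at hu
      exact (by simpa using hu : ‖u‖ ≤ r).trans hrR
  · exact CircleIntegrable.fun_sum _ fun w _ => (circleIntegrable_log_norm_sub_const r).const_mul _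

/-- A consequence of Jensen's formula. The zeros of modulus at most one are counted
with the same weight as those on the unit circle, so that nothing need be assumed at the origin. -/
lemma zeroNum_mul_log_le {f : ℂ → ℂ} (hf : Differentiable ℂ f) (h0 : f ≠ 0) {r R : ℝ}
    (hr : 1 ≤ r) (hrR : r ≤ R) :
    zeroNum f r * log (R / r) ≤ circleMean f R - circleMean f 1 := by
  obtain ⟨g, hg, hgR, hfg⟩ := exists_factorization hf h0 R
  have hR : 0 < R := by linarith
  rw [circleMean_eq hf h0 hR le_rfl hg hgR hfg,
    circleMean_eq hf h0 one_pos (hr.trans hrR) hg hgR hfg, add_sub_add_right_eq_sub,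
    ← Finset.sum_sub_distrib, zeroNum, Finset.sum_mul]
  have hsub : zeroFinset f r ⊆ zeroFinset f R := fun w hw => by
    rw [mem_zeroFinset hf h0] at hw ⊢
    exact ⟨hw.1.trans hrR, hw.2⟩
  have hterm : ∀ w ∈ zeroFinset f R, log R + posLog (R⁻¹ * ‖w‖) = log R := by
    intro w hw
    rw [mem_zeroFinset hf h0] at hw
    rw [add_eq_left, posLog_eq_zero_iff, abs_of_nonneg (by positivity)]
    exact inv_mul_le_one_of_le₀ hw.1 hR.le
  have hpos : ∀ w : ℂ, ∀ s : ℝ, 1 ≤ s → ‖w‖ ≤ s → posLog ‖w‖ ≤ log s := by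
    intro w s hs hw
    rw [← posLog_eq_log (by rwa [abs_of_nonneg (by linarith)])]
    exact posLog_le_posLog (norm_nonneg _) hw
  refine (Finset.sum_le_sum fun w hw => ?_).trans
    (Finset.sum_le_sum_of_subset_of_nonneg hsub fun w hw _ => ?_)
  · rw [hterm w (hsub hw), log_div hR.ne' (by linarith), ← mul_sub]
    rw [mem_zeroFinset hf h0] at hw
    have := hpos w r hr hw.1
    simp only [log_one, inv_one, one_mul, zero_add]
    gcongr
  · rw [hterm w hw, ← mul_sub]
    rw [mem_zeroFinset hf h0] at hw
    have := hpos w R (hr.trans hrR) hw.1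
    simp only [log_one, inv_one, one_mul, zero_add]
    exact mul_nonneg (Nat.cast_nonneg _) (by linarith)

/-! ### Fourier coefficients of `log |f|` on circles -/

/-- The `l`-th Fourier coefficient of `θ ↦ u (r * exp (i θ))`, for `l ≥ 0`. -/
def circleCoeff (u : ℂ → ℝ) (r : ℝ) (l : ℕ) : ℂ :=
  circleAverage (fun z => (u z : ℂ) * ((r : ℂ) / z) ^ l) 0 r

lemma circleAverage_zpow {r : ℝ} (hr : r ≠ 0) {n : ℤ} (hn : n ≠ 0) :
    circleAverage (fun z : ℂ => z ^ n) 0 r = 0 := by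
  rw [circleAverage_eq_circleIntegral hr]
  have h : (∮ z in C((0 : ℂ), r), (z - 0)⁻¹ • z ^ n) = ∮ z in C((0 : ℂ), r), (z - 0) ^ (n - 1) := by
    unfold circleIntegral
    congr with θ
    have : circleMap 0 r θ ≠ 0 := circleMap_ne_center hr
    simp only [sub_zero, smul_eq_mul]
    rw [zpow_sub_one₀ this, mul_comm (circleMap 0 r θ)⁻¹]
  rw [h, circleIntegral.integral_sub_zpow_of_ne (by omega), smul_zero]

lemma norm_circleMap_zero_of_pos {r : ℝ} (hr : 0 < r) (θ : ℝ) : ‖circleMap 0 r θ‖ = r := by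
  rw [norm_circleMap_zero, abs_of_pos hr]

lemma circleCoeff_re_term {r : ℝ} (hr : 0 < r) {l : ℕ} (hl : 1 ≤ l) (b : ℂ) (j : ℕ) :
    circleAverage (fun z => ((b * z ^ j).re : ℂ) * ((r : ℂ) / z) ^ l) 0 r =
      if j = l then b * (r : ℂ) ^ l / 2 else 0 := by
  have hcongr : circleAverage (fun z => ((b * z ^ j).re : ℂ) * ((r : ℂ) / z) ^ l) 0 r =
      circleAverage (fun z => (b * (r : ℂ) ^ l / 2) • z ^ ((j : ℤ) - l) +
        (conj b * (r : ℂ) ^ (2 * j + l) / 2) • z ^ (-(j : ℤ) - l)) 0 r := by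
    refine circleAverage_congr_sphere fun z hz => ?_
    rw [abs_of_pos hr, mem_sphere_zero_iff_norm] at hz
    have hz0 : z ≠ 0 := norm_ne_zero_iff.1 (by rw [hz]; exact hr.ne')
    have hc : conj z = (r : ℂ) ^ 2 / z := by
      rw [eq_div_iff hz0, mul_comm, Complex.mul_conj, Complex.normSq_eq_norm_sq, hz]
      push_cast; rfl
    simp only [smul_eq_mul]
    rw [Complex.re_eq_add_conj, map_mul, map_pow, hc, zpow_sub₀ hz0, zpow_sub₀ hz0, zpow_neg]
    simp only [zpow_natCast, div_pow, ← pow_mul]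
    have hj : z ^ j ≠ 0 := pow_ne_zero _ hz0
    have hl' : z ^ l ≠ 0 := pow_ne_zero _ hz0
    rw [pow_add]
    generalize z ^ j = A at *
    generalize z ^ l = B at *
    generalize (r : ℂ) ^ (2 * j) = C at *
    generalize (r : ℂ) ^ l = D at *
    field_simp
  have hint : ∀ n : ℤ, ∀ c : ℂ, CircleIntegrable (fun z : ℂ => c • z ^ n) 0 r := by
    intro n c
    refine ContinuousOn.circleIntegrable hr.le fun z hz => ContinuousAt.continuousWithinAt ?_
    have hz0 : z ≠ 0 := by
      rintro rfl
      simp [hr.ne] at hz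
    exact (continuousAt_zpow₀ z n (Or.inl hz0)).const_smul c
  rw [hcongr, circleAverage_fun_add (hint _ _) (hint _ _), circleAverage_fun_smul,
    circleAverage_fun_smul, circleAverage_zpow hr.ne' (n := -(j : ℤ) - l) (by omega)]
  split_ifs with h
  · subst h
    simp [circleAverage_const]
  · rw [circleAverage_zpow hr.ne' (by omega)]
    simp

/-- The Fourier coefficients of the real part of a power series. -/
lemma circleCoeff_re_powerSeries {r : ℝ} (hr : 0 < r) {a : ℕ → ℂ} {h : ℂ → ℂ}
    (ha : Summable fun j => ‖a j‖ * r ^ j)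
    (hsum : ∀ z, ‖z‖ = r → HasSum (fun j => a j * z ^ j) (h z)) {u : ℂ → ℝ}
    (hu : ∀ z, ‖z‖ = r → u z = (h z).re) {l : ℕ} (hl : 1 ≤ l) :
    circleCoeff u r l = a l * (r : ℂ) ^ l / 2 := by
  have hterm : HasSum (fun j => circleAverage
      (fun z => ((a j * z ^ j).re : ℂ) * ((r : ℂ) / z) ^ l) 0 r) (circleCoeff u r l) := by
    unfold circleCoeff circleAverage
    refine HasSum.const_smul _ ?_
    refine intervalIntegral.hasSum_integral_of_dominated_convergence
      (fun j _ => ‖a j‖ * r ^ j) ?_ ?_ ?_ ?_ ?_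
    · intro j
      refine Continuous.aestronglyMeasurable ?_
      refine (Complex.continuous_ofReal.comp (Complex.continuous_re.comp (by fun_prop))).mul
        ((Continuous.div (by fun_prop) (continuous_circleMap 0 r) fun θ =>
          circleMap_ne_center hr.ne').pow l)
    · intro j
      refine Eventually.of_forall fun θ _ => ?_
      rw [norm_mul, norm_pow, norm_div, norm_circleMap_zero_of_pos hr, Complex.norm_real,
        Complex.norm_real, norm_of_nonneg hr.le, div_self hr.ne', one_pow, mul_one]
      refine (Complex.abs_re_le_norm _).trans ?_
      rw [norm_mul, norm_pow, norm_circleMap_zero_of_pos hr]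
    · exact Eventually.of_forall fun θ _ => ha
    · exact intervalIntegrable_const
    · refine Eventually.of_forall fun θ _ => ?_
      have hz := norm_circleMap_zero_of_pos hr θ
      simp only [hu _ hz]
      refine HasSum.mul_right _ ?_
      exact Complex.hasSum_ofReal.2 (Complex.hasSum_re (hsum _ hz))
  have h2 := hasSum_ite_eq l (a l * (r : ℂ) ^ l / 2)
  refine hterm.unique ?_
  convert h2 using 2 with j
  rw [circleCoeff_re_term hr hl]
  split_ifs with hj
  · rw [hj]
  · rfl

lemma circleCoeff_const_add_log {r : ℝ} (hr : 0 < r) {b : ℂ} (hb : ‖b‖ * r < 1) {c : ℝ} {u : ℂ → ℝ}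
    (hu : ∀ z, ‖z‖ = r → u z = c + log ‖1 - b * z‖) {l : ℕ} (hl : 1 ≤ l) :
    circleCoeff u r l = -(1 / (2 * l)) * (b * r) ^ l := by
  set a : ℕ → ℂ := fun j => (if j = 0 then (c : ℂ) else 0) + -(b ^ j / j) with ha
  have hlt : ∀ z : ℂ, ‖z‖ = r → ‖b * z‖ < 1 := fun z hz => by rwa [norm_mul, hz]
  rw [circleCoeff_re_powerSeries hr (a := a) (h := fun z => c + Complex.log (1 - b * z))
    ?_ ?_ ?_ hl]
  · rw [ha]
    simp only [if_neg (show l ≠ 0 by omega), zero_add, mul_pow]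
    have : (l : ℂ) ≠ 0 := by exact_mod_cast (show l ≠ 0 by omega)
    field_simp
  · have h1 : Summable fun j : ℕ => (‖b‖ * r) ^ j :=
      summable_geometric_of_lt_one (by positivity) hb
    have h2 : Summable fun j : ℕ => (if j = 0 then |c| else 0) :=
      (hasSum_ite_eq 0 |c|).summable
    refine Summable.of_nonneg_of_le (fun j => by positivity) (fun j => ?_) (h2.add h1)
    rcases Nat.eq_zero_or_pos j with rfl | hj
    · simp [ha]
    · rw [ha]
      simp only [if_neg hj.ne', zero_add, norm_neg, norm_div, norm_pow, mul_pow,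
        Complex.norm_natCast]
      gcongr
      exact div_le_self (by positivity) (by exact_mod_cast hj)
  · intro z hz
    have h1 := (Complex.hasSum_taylorSeries_neg_log (hlt z hz)).neg
    rw [neg_neg] at h1
    have h2 := (hasSum_ite_eq 0 (c : ℂ)).add h1
    convert h2 using 2 with j
    rw [ha]
    rcases Nat.eq_zero_or_pos j with rfl | hj
    · simp
    · simp only [if_neg hj.ne', zero_add, mul_pow]
      ring
  · intro z hz
    rw [hu z hz, Complex.add_re, Complex.ofReal_re, Complex.log_re]

lemma circleCoeff_log_sub_of_lt_norm {r : ℝ} (hr : 0 < r) {w : ℂ} (hw : r < ‖w‖) {l : ℕ}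
    (hl : 1 ≤ l) :
    circleCoeff (fun z => log ‖z - w‖) r l = -(1 / (2 * l)) * (r / w) ^ l := by
  have hw0 : w ≠ 0 := norm_pos_iff.1 (hr.trans hw)
  rw [circleCoeff_const_add_log hr (b := w⁻¹) (c := log ‖w‖) _ _ hl, inv_mul_eq_div]
  · rw [norm_inv, inv_mul_eq_div]
    exact (div_lt_one (hr.trans hw)).2 hw
  · intro z hz
    have hne : 1 - w⁻¹ * z ≠ 0 := by
      intro h
      have : w = z := by field_simp at h; linear_combination h
      rw [this] at hw
      exact hw.ne' hz
    rw [← log_mul (norm_ne_zero_iff.2 hw0) (norm_ne_zero_iff.2 hne), ← norm_mul, mul_sub,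
      mul_inv_cancel_left₀ hw0, mul_one, norm_sub_rev]

/-- On the circle of radius `r`, the modulus of `z - w` equals that of `r - conj w * z / r`, whose
logarithm is harmonic in the disc; this is the reflection of the zero in the circle. -/
lemma circleCoeff_log_sub_of_norm_lt {r : ℝ} (hr : 0 < r) {w : ℂ} (hw : ‖w‖ < r) {l : ℕ}
    (hl : 1 ≤ l) :
    circleCoeff (fun z => log ‖z - w‖) r l = -(1 / (2 * l)) * (conj w / r) ^ l := by
  have hrC : (r : ℂ) ≠ 0 := by exact_mod_cast hr.ne'
  have hb : ‖conj w / (r : ℂ) ^ 2‖ * r < 1 := by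
    rw [norm_div, Complex.norm_conj, norm_pow, Complex.norm_real, norm_of_nonneg hr.le]
    field_simp
    exact hw
  rw [circleCoeff_const_add_log hr (b := conj w / (r : ℂ) ^ 2) (c := log r) hb _ hl]
  · congr 2
    field_simp
  · intro z hz
    have hz0 : z ≠ 0 := norm_pos_iff.1 (hz ▸ hr)
    have hlt : ‖conj w / (r : ℂ) ^ 2 * z‖ < 1 := by rwa [norm_mul, hz]
    have hne : 1 - conj w / (r : ℂ) ^ 2 * z ≠ 0 := by
      intro h
      rw [← sub_eq_zero.1 h, norm_one] at hlt
      exact lt_irrefl _ hlt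
    rw [← log_mul hr.ne' (norm_ne_zero_iff.2 hne)]
    congr 1
    have hc : z * conj z = (r : ℂ) ^ 2 := by
      rw [Complex.mul_conj, Complex.normSq_eq_norm_sq, hz]
      push_cast; rfl
    have h1 : z - w = z * conj (1 - conj w / (r : ℂ) ^ 2 * z) := by
      simp only [map_sub, map_one, map_mul, map_div₀, map_pow, Complex.conj_conj,
        Complex.conj_ofReal]
      rw [← hc]
      have : conj z ≠ 0 := by simpa using hz0
      field_simp
    rw [h1, norm_mul, Complex.norm_conj, hz]

/-- For a function without zeros in the disc, the Fourier coefficients of `log |g|` scale with the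
radius like those of the real part of a power series. -/
lemma exists_circleCoeff_log_eq {g : ℂ → ℂ} (hg : Differentiable ℂ g) {R : ℝ} (hR : 0 < R)
    (hgR : ∀ z, ‖z‖ ≤ R → g z ≠ 0) :
    ∃ a : ℕ → ℂ, ∀ r : ℝ, 0 < r → r ≤ R → ∀ l : ℕ, 1 ≤ l →
      circleCoeff (fun z => log ‖g z‖) r l = a l * (r : ℂ) ^ l := by
  have hopen : IsOpen {z | g z ≠ 0} := isOpen_ne.preimage hg.continuous
  obtain ⟨δ, hδ, hsub⟩ := (isCompact_closedBall (0 : ℂ) R).exists_thickening_subset_open hopen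
    fun z hz => hgR z (by simpa using hz)
  rw [thickening_closedBall hδ hR.le] at hsub
  have hharm : InnerProductSpace.HarmonicOnNhd (fun z => log ‖g z‖) (ball 0 (δ + R)) :=
    fun z hz => (hg.analyticAt z).harmonicAt_log_norm (hsub hz)
  obtain ⟨h, hh, hre⟩ := hharm.exists_analyticOnNhd_ball_re_eq
  set ρ : NNReal := ⟨δ / 2 + R, by positivity⟩ with hρ
  have hρ' : (ρ : ℝ) = δ / 2 + R := rfl
  have hdiff : DifferentiableOn ℂ h (closedBall 0 (ρ : ℝ)) :=
    hh.differentiableOn.mono fun z hz => by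
      rw [mem_closedBall, hρ'] at hz; rw [mem_ball]; linarith
  have hpow := hdiff.hasFPowerSeriesOnBall (show 0 < ρ from (by positivity : 0 < δ / 2 + R))
  set p := cauchyPowerSeries h 0 (ρ : ℝ) with hp
  refine ⟨fun l => p.coeff l / 2, fun r hr hrR l hl => ?_⟩
  lift r to NNReal using hr.le
  have hrρ : r < ρ := by
    rw [← NNReal.coe_lt_coe, hρ']; linarith
  rw [circleCoeff_re_powerSeries hr (a := p.coeff) (h := h) _ _ _ hl]
  · ring
  · have := p.summable_norm_mul_pow (r := r) ((ENNReal.coe_lt_coe.2 hrρ).trans_le hpow.r_le)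
    simpa only [FormalMultilinearSeries.norm_apply_eq_norm_coef] using this
  · intro z hz
    have hz' : z ∈ Metric.eball (0 : ℂ) (ρ : ℝ≥0∞) := by
      rw [Metric.eball_coe, mem_ball_zero_iff, hz]
      exact_mod_cast hrρ
    have := hpow.hasSum hz'
    have e : (fun n => p n fun _ => z) = fun j => p.coeff j * z ^ j := by
      funext j
      rw [FormalMultilinearSeries.apply_eq_prod_smul_coeff]
      simp [mul_comm]
    rwa [zero_add, e] at this
  · intro z hz
    refine (hre ?_).symm
    rw [mem_ball_zero_iff, hz]
    linarith

lemma circleIntegrable_mul_pow {u : ℂ → ℝ} {r : ℝ} (hr : 0 < r) (hu : CircleIntegrable u 0 r)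
    (l : ℕ) : CircleIntegrable (fun z => (u z : ℂ) * ((r : ℂ) / z) ^ l) 0 r := by
  unfold CircleIntegrable at *
  refine IntervalIntegrable.mul_continuousOn ⟨hu.1.ofReal, hu.2.ofReal⟩ (Continuous.continuousOn ?_)
  exact ((Continuous.div (by fun_prop) (continuous_circleMap 0 r) fun θ =>
          circleMap_ne_center hr.ne').pow l)

lemma circleCoeff_log_eq_sum {f g : ℂ → ℂ} {S : Finset ℂ} (hg : Differentiable ℂ g)
    (hfg : ∀ z, f z = (∏ w ∈ S, (z - w) ^ mult f w) * g z) {r : ℝ} (hr : 0 < r)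
    (hgen : ∀ z, ‖z‖ = r → f z ≠ 0) (l : ℕ) :
    circleCoeff (fun z => log ‖f z‖) r l =
      ∑ w ∈ S, (mult f w : ℂ) * circleCoeff (fun z => log ‖z - w‖) r l +
        circleCoeff (fun z => log ‖g z‖) r l := by
  have hcongr : circleCoeff (fun z => log ‖f z‖) r l = circleAverage
      (fun z => (∑ w ∈ S, (mult f w : ℂ) • ((log ‖z - w‖ : ℂ) * ((r : ℂ) / z) ^ l)) +
        (log ‖g z‖ : ℂ) * ((r : ℂ) / z) ^ l) 0 r := by
    refine circleAverage_congr_sphere fun z hz => ?_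
    rw [abs_of_pos hr, mem_sphere_zero_iff_norm] at hz
    simp only [log_norm_factorization hfg (hgen z hz)]
    push_cast
    rw [add_mul, Finset.sum_mul]
    simp only [smul_eq_mul, mul_assoc]
  have hint : ∀ w : ℂ, CircleIntegrable
      (fun z => (mult f w : ℂ) • ((log ‖z - w‖ : ℂ) * ((r : ℂ) / z) ^ l)) 0 r := fun w =>
    (circleIntegrable_mul_pow hr (circleIntegrable_log_norm_sub_const r) l).const_smul
  rw [hcongr, circleAverage_fun_add (CircleIntegrable.fun_sum _ fun w _ => hint w)
    (circleIntegrable_mul_pow hr (circleIntegrable_log hg r) l),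
    circleAverage_fun_sum fun w _ => hint w]
  simp_rw [circleAverage_fun_smul]
  rfl

/-- The Fourier coefficients of `log |f|` on two circles that avoid the zeros of `f`. -/
lemma circleCoeff_log_two_radii {f : ℂ → ℂ} (hf : Differentiable ℂ f) (h0 : f ≠ 0) {r R : ℝ}
    (hr : 0 < r) (hrR : r < R) (hgen : ∀ z, ‖z‖ = r → f z ≠ 0) (hgenR : ∀ z, ‖z‖ = R → f z ≠ 0)
    {l : ℕ} (hl : 1 ≤ l) :
    circleCoeff (fun z => log ‖f z‖) r l =
      -(1 / (2 * l)) * (∑ w ∈ zeroFinset f r, (mult f w : ℂ) * (conj w / r) ^ l +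
        ∑ w ∈ zeroFinset f R with r ≤ ‖w‖, (mult f w : ℂ) * (r / w) ^ l) +
      (r / R) ^ l * (circleCoeff (fun z => log ‖f z‖) R l +
        (1 / (2 * l)) * ∑ w ∈ zeroFinset f R, (mult f w : ℂ) * (conj w / R) ^ l) := by
  have hR : 0 < R := hr.trans hrR
  have hRC : (R : ℂ) ≠ 0 := by exact_mod_cast hR.ne'
  obtain ⟨g, hg, hgR, hfg⟩ := exists_factorization hf h0 R
  obtain ⟨a, ha⟩ := exists_circleCoeff_log_eq hg hR hgR
  rw [circleCoeff_log_eq_sum hg hfg hr hgen, circleCoeff_log_eq_sum hg hfg hR hgenR,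
    ha r hr hrR.le l hl, ha R hR le_rfl l hl]
  have h1 : ∑ w ∈ zeroFinset f R, (mult f w : ℂ) * circleCoeff (fun z => log ‖z - w‖) R l =
      -(1 / (2 * l)) * ∑ w ∈ zeroFinset f R, (mult f w : ℂ) * (conj w / R) ^ l := by
    rw [Finset.mul_sum]
    refine Finset.sum_congr rfl fun w hw => ?_
    rw [mem_zeroFinset hf h0] at hw
    rw [circleCoeff_log_sub_of_norm_lt hR
      (lt_of_le_of_ne hw.1 fun h => hgenR w h hw.2) hl]
    ring
  have h2 : ∑ w ∈ zeroFinset f R, (mult f w : ℂ) * circleCoeff (fun z => log ‖z - w‖) r l =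
      -(1 / (2 * l)) * (∑ w ∈ zeroFinset f r, (mult f w : ℂ) * (conj w / r) ^ l +
        ∑ w ∈ zeroFinset f R with r ≤ ‖w‖, (mult f w : ℂ) * (r / w) ^ l) := by
    have hsplit : zeroFinset f r = (zeroFinset f R).filter (fun w => ¬ r ≤ ‖w‖) := by
      ext w
      rw [Finset.mem_filter, mem_zeroFinset hf h0, mem_zeroFinset hf h0]
      constructor
      · rintro ⟨h, h'⟩
        exact ⟨⟨h.trans hrR.le, h'⟩, not_le.2 (lt_of_le_of_ne h fun e => hgen w e h')⟩
      · rintro ⟨⟨_, h'⟩, h⟩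
        exact ⟨(not_le.1 h).le, h'⟩
    rw [hsplit, ← Finset.sum_filter_add_sum_filter_not (zeroFinset f R) (fun w => r ≤ ‖w‖),
      mul_add, add_comm, Finset.mul_sum, Finset.mul_sum]
    congr 1
    · refine Finset.sum_congr rfl fun w hw => ?_
      rw [circleCoeff_log_sub_of_norm_lt hr (not_le.1 (Finset.mem_filter.1 hw).2) hl]
      ring
    · refine Finset.sum_congr rfl fun w hw => ?_
      have hw' := Finset.mem_filter.1 hw
      rw [mem_zeroFinset hf h0] at hw'
      rw [circleCoeff_log_sub_of_lt_norm hr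
        (lt_of_le_of_ne hw'.2 fun e => hgen w e.symm hw'.1.2) hl]
      ring
  rw [h1, h2, div_pow]
  have : (R : ℂ) ^ l ≠ 0 := pow_ne_zero _ hRC
  generalize (R : ℂ) ^ l = B at *
  field_simp
  ring

/-! ### Growth of functions of order less than one -/

lemma log_factorial_le (j : ℕ) : log (j.factorial : ℝ) ≤ j * log j := by
  have h : (j.factorial : ℝ) ≤ (j : ℝ) ^ j := by exact_mod_cast Nat.factorial_le_pow j
  calc log (j.factorial : ℝ) ≤ log ((j : ℝ) ^ j) :=
        log_le_log (by exact_mod_cast j.factorial_pos) h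
    _ = j * log j := by rw [log_pow]

lemma hasSum_taylorCoeff {f : ℂ → ℂ} (hf : Differentiable ℂ f) (z : ℂ) :
    HasSum (fun j => taylorCoeff f j * z ^ j) (f z) := by
  have := Complex.hasSum_taylorSeries_of_entire hf 0 z
  have e : (fun n : ℕ => (n.factorial : ℂ)⁻¹ • (z - 0) ^ n • iteratedDeriv n f 0) =
      fun j => taylorCoeff f j * z ^ j := by
    funext j
    simp only [taylorCoeff, sub_zero, smul_eq_mul]
    ring
  rwa [e] at this

/-- The coefficients of an entire function of order less than one decay like a power of `1 / j!`
with exponent larger than one. -/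
lemma IsGenusZero.exists_taylorCoeff_le {f : ℂ → ℂ} (hf : IsGenusZero f) :
    ∃ σ : ℝ, 0 < σ ∧ σ < 1 ∧ ∃ B : ℝ, 1 ≤ B ∧
      ∀ j, ‖taylorCoeff f j‖ ≤ B * ((j.factorial : ℝ)⁻¹) ^ (1 / σ) := by
  obtain ⟨σ₀, h₁, h₂⟩ := EReal.lt_iff_exists_real_btwn.1 hf.order_lt_one
  have h₂' : σ₀ < 1 := by exact_mod_cast h₂
  -- The order may be negative; the exponent is kept positive.
  set σ := max σ₀ (1 / 2) with hσ
  have hσ0 : 0 < σ := lt_of_lt_of_le (by norm_num) (le_max_right _ _)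
  have hσ1 : σ < 1 := max_lt h₂' (by norm_num)
  refine ⟨σ, hσ0, hσ1, ?_⟩
  have hlim : Tendsto (fun j => ‖taylorCoeff f j‖) atTop (𝓝 0) := by
    have := (hasSum_taylorCoeff hf.entire 1).summable.tendsto_atTop_zero.norm
    simpa using this
  have hev : ∀ᶠ j : ℕ in atTop, ‖taylorCoeff f j‖ ≤ ((j.factorial : ℝ)⁻¹) ^ (1 / σ) := by
    filter_upwards [eventually_lt_of_limsup_lt h₁, hlim.eventually_lt_const one_pos]
      with j hj hj1
    have hj' : (j : ℝ) * log j / log (1 / ‖taylorCoeff f j‖) < σ := by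
      have : (j : ℝ) * log j / log (1 / ‖taylorCoeff f j‖) < σ₀ := by exact_mod_cast hj
      exact this.trans_le (le_max_left _ _)
    have hfac : (0 : ℝ) < j.factorial := by exact_mod_cast j.factorial_pos
    rcases eq_or_ne (taylorCoeff f j) 0 with h | h
    · rw [h, norm_zero]; positivity
    have hpos : 0 < ‖taylorCoeff f j‖ := norm_pos_iff.2 h
    have hL : 0 < log (1 / ‖taylorCoeff f j‖) := log_pos (one_lt_one_div hpos hj1)
    rw [div_lt_iff₀ hL, one_div, log_inv] at hj'
    rw [← log_le_log_iff hpos (by positivity), log_rpow (by positivity), log_inv,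
      one_div, inv_mul_eq_div, le_div_iff₀ hσ0]
    have := log_factorial_le j
    linarith
  obtain ⟨J, hJ⟩ := eventually_atTop.1 hev
  refine ⟨1 + ∑ i ∈ Finset.range J, ‖taylorCoeff f i‖ / ((i.factorial : ℝ)⁻¹) ^ (1 / σ), ?_, ?_⟩
  · have : 0 ≤ ∑ i ∈ Finset.range J, ‖taylorCoeff f i‖ / ((i.factorial : ℝ)⁻¹) ^ (1 / σ) :=
      Finset.sum_nonneg fun i _ => by positivity
    linarith
  · intro j
    have hfac : (0 : ℝ) < j.factorial := by exact_mod_cast j.factorial_pos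
    have hp : 0 < ((j.factorial : ℝ)⁻¹) ^ (1 / σ) := by positivity
    rcases lt_or_ge j J with h | h
    · rw [← div_le_iff₀ hp]
      have := Finset.single_le_sum
        (f := fun i => ‖taylorCoeff f i‖ / ((i.factorial : ℝ)⁻¹) ^ (1 / σ))
        (fun i _ => by positivity) (Finset.mem_range.2 h)
      linarith
    · refine (hJ j h).trans (le_mul_of_one_le_left hp.le ?_)
      have : 0 ≤ ∑ i ∈ Finset.range J, ‖taylorCoeff f i‖ / ((i.factorial : ℝ)⁻¹) ^ (1 / σ) :=
        Finset.sum_nonneg fun i _ => by positivity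
      linarith

lemma norm_le_of_taylorCoeff_le {f : ℂ → ℂ} (hf : Differentiable ℂ f) {σ B : ℝ} (hσ0 : 0 < σ)
    (hσ1 : σ < 1) (hB : 0 ≤ B)
    (h : ∀ j, ‖taylorCoeff f j‖ ≤ B * ((j.factorial : ℝ)⁻¹) ^ (1 / σ)) (z : ℂ) :
    ‖f z‖ ≤ B * exp (‖z‖ ^ σ / σ) := by
  set x := ‖z‖ ^ σ with hx
  have hx0 : 0 ≤ x := by positivity
  have hexp : HasSum (fun j : ℕ => x ^ j / (j.factorial : ℝ)) (exp x) := by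
    rw [Real.exp_eq_exp_ℝ]
    exact NormedSpace.expSeries_div_hasSum_exp x
  have hs := (hexp.mul_left (exp (x * (1 / σ - 1)))).mul_left B
  have hval : B * (exp (x * (1 / σ - 1)) * exp x) = B * exp (x / σ) := by
    rw [← exp_add]; congr 2; field_simp; ring
  rw [hval] at hs
  -- With `y = x ^ j / j!`, the `j`-th term is at most
  -- `B * y ^ (1 / σ) ≤ B * exp x ^ (1 / σ - 1) * y`.
  refine (hasSum_taylorCoeff hf z).norm_le_of_bounded hs fun j => ?_
  have hfac : (0 : ℝ) < j.factorial := by exact_mod_cast j.factorial_pos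
  set y := x ^ j / (j.factorial : ℝ) with hy
  have hy0 : 0 ≤ y := by positivity
  have hye : y ≤ exp x := pow_div_factorial_le_exp x hx0 j
  have hσ' : 0 ≤ 1 / σ - 1 := by
    rw [sub_nonneg, le_div_iff₀ hσ0]; linarith
  have hy1 : y ^ (1 / σ) = ‖z‖ ^ j * ((j.factorial : ℝ)⁻¹) ^ (1 / σ) := by
    rw [hy, div_eq_mul_inv, mul_rpow (by positivity) (by positivity), hx, ← rpow_natCast,
      ← rpow_mul (norm_nonneg _), ← rpow_mul (norm_nonneg _), ← rpow_natCast]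
    congr 2
    field_simp
  calc ‖taylorCoeff f j * z ^ j‖ = ‖taylorCoeff f j‖ * ‖z‖ ^ j := by rw [norm_mul, norm_pow]
    _ ≤ B * ((j.factorial : ℝ)⁻¹) ^ (1 / σ) * ‖z‖ ^ j := by gcongr; exact h j
    _ = B * y ^ (1 / σ) := by rw [hy1]; ring
    _ ≤ B * (exp (x * (1 / σ - 1)) * y) := by
        gcongr
        rcases hy0.eq_or_lt with h0 | h0
        · rw [← h0, zero_rpow (by positivity), mul_zero]
        · have : y ^ (1 / σ) = y ^ (1 / σ - 1) * y := by
            rw [← rpow_add_one h0.ne']; congr 1; ring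
          rw [this]
          gcongr
          calc y ^ (1 / σ - 1) ≤ (exp x) ^ (1 / σ - 1) := by gcongr
            _ = exp (x * (1 / σ - 1)) := by rw [exp_mul]

lemma IsGenusZero.exists_log_le {f : ℂ → ℂ} (hf : IsGenusZero f) :
    ∃ σ : ℝ, 0 < σ ∧ σ < 1 ∧ ∃ A : ℝ, 0 ≤ A ∧
      ∀ z : ℂ, 1 ≤ ‖z‖ → log ‖f z‖ ≤ A * ‖z‖ ^ σ := by
  obtain ⟨σ, hσ0, hσ1, B, hB, h⟩ := hf.exists_taylorCoeff_le
  refine ⟨σ, hσ0, hσ1, log B + 1 / σ, add_nonneg (log_nonneg hB) (by positivity), fun z hz => ?_⟩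
  have hz' : 1 ≤ ‖z‖ ^ σ := one_le_rpow hz hσ0.le
  have hlB := log_nonneg hB
  -- At a zero of `f` the logarithm has the value `0`.
  rcases eq_or_ne (f z) 0 with h0 | h0
  · rw [h0, norm_zero, log_zero]; positivity
  calc log ‖f z‖ ≤ log (B * exp (‖z‖ ^ σ / σ)) :=
        log_le_log (norm_pos_iff.2 h0)
          (norm_le_of_taylorCoeff_le hf.entire hσ0 hσ1 (by linarith) h z)
    _ = log B + ‖z‖ ^ σ / σ := by rw [log_mul (by positivity) (exp_ne_zero _), log_exp]
    _ ≤ (log B + 1 / σ) * ‖z‖ ^ σ := by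
        rw [add_mul, one_div_mul_eq_div]
        gcongr
        exact le_mul_of_one_le_right hlB hz'

lemma circleMean_mono {f : ℂ → ℂ} (hf : Differentiable ℂ f) (h0 : f ≠ 0) {R : ℝ} (hR : 1 ≤ R) :
    circleMean f 1 ≤ circleMean f R := by
  have := zeroNum_mul_log_le hf h0 le_rfl hR
  have h2 : 0 ≤ zeroNum f 1 * log (R / 1) :=
    mul_nonneg (zeroNum_nonneg _ _) (log_nonneg (by simpa using hR))
  linarith

lemma zeroNum_mono {f : ℂ → ℂ} (hf : Differentiable ℂ f) (h0 : f ≠ 0) {r R : ℝ} (h : r ≤ R) :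
    zeroNum f r ≤ zeroNum f R := by
  refine Finset.sum_le_sum_of_subset_of_nonneg (fun w hw => ?_) fun _ _ _ => Nat.cast_nonneg _
  rw [mem_zeroFinset hf h0] at hw ⊢
  exact ⟨hw.1.trans h, hw.2⟩

lemma norm_circleCoeff_le {u : ℂ → ℝ} {r : ℝ} (hr : 0 < r) (l : ℕ) :
    ‖circleCoeff u r l‖ ≤ circleAverage (fun z => |u z|) 0 r := by
  unfold circleCoeff circleAverage
  rw [norm_smul, norm_of_nonneg (by positivity), smul_eq_mul]
  gcongr
  refine (intervalIntegral.norm_integral_le_integral_norm two_pi_pos.le).trans_eq ?_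
  congr with θ
  rw [norm_mul, norm_pow, norm_div, norm_circleMap_zero_of_pos hr, Complex.norm_real,
        Complex.norm_real, norm_of_nonneg hr.le, div_self hr.ne', one_pow, mul_one, norm_eq_abs]

lemma circleIntegrable_log_pos {f : ℂ → ℂ} (hf : Differentiable ℂ f) (r : ℝ) :
    CircleIntegrable (fun z => max (log ‖f z‖) 0) 0 r :=
  ⟨(circleIntegrable_log hf r).1.pos_part, (circleIntegrable_log hf r).2.pos_part⟩

lemma circleAverage_abs_log {f : ℂ → ℂ} (hf : Differentiable ℂ f) (r : ℝ) :
    circleAverage (fun z => |log ‖f z‖|) 0 r =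
      2 * circleAverage (fun z => max (log ‖f z‖) 0) 0 r - circleMean f r := by
  have h : (fun z => |log ‖f z‖|) = fun z => (2 : ℝ) • max (log ‖f z‖) 0 - log ‖f z‖ := by
    funext z
    rw [smul_eq_mul]
    rcases le_total 0 (log ‖f z‖) with h | h
    · rw [abs_of_nonneg h, max_eq_left h]; ring
    · rw [abs_of_nonpos h, max_eq_right h]; ring
  have hint : CircleIntegrable (fun z => (2 : ℝ) • max (log ‖f z‖) 0) 0 r :=
    (circleIntegrable_log_pos hf r).const_smul
  rw [h, circleAverage_fun_sub hint
    (circleIntegrable_log hf r), circleAverage_fun_smul]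
  rfl

/-- The number of zeros and the `L¹` norm of `log |f|` on circles grow slower than linearly. -/
lemma IsGenusZero.exists_growth {f : ℂ → ℂ} (hf : IsGenusZero f) :
    ∃ σ : ℝ, 0 < σ ∧ σ < 1 ∧ ∃ C : ℝ, 0 ≤ C ∧ ∀ r : ℝ, 1 ≤ r → zeroNum f r ≤ C * r ^ σ ∧
      circleAverage (fun z => |log ‖f z‖|) 0 r ≤ C * r ^ σ := by
  obtain ⟨σ, hσ0, hσ1, A, hA, h⟩ := hf.exists_log_le
  have hl2 : 0 < log 2 := log_pos (by norm_num)
  refine ⟨σ, hσ0, hσ1, (A * 2 ^ σ + |circleMean f 1|) / log 2 + (2 * A + |circleMean f 1|),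
    by positivity, fun r hr => ?_⟩
  have hr0 : 0 < r := by linarith
  have hrσ : 1 ≤ r ^ σ := one_le_rpow hr hσ0.le
  have hpos : ∀ s : ℝ, 1 ≤ s →
      circleAverage (fun z => max (log ‖f z‖) 0) 0 s ≤ A * s ^ σ := by
    intro s hs
    refine circleAverage_mono_on_of_le_circle (circleIntegrable_log_pos hf.entire s) fun z hz => ?_
    rw [abs_of_pos (by linarith), mem_sphere_zero_iff_norm] at hz
    have := h z (hz ▸ hs)
    rw [hz] at this
    exact max_le this (by positivity)
  have hmean : ∀ s : ℝ, 1 ≤ s → circleMean f s ≤ A * s ^ σ := by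
    intro s hs
    refine circleAverage_mono_on_of_le_circle (circleIntegrable_log hf.entire s) fun z hz => ?_
    rw [abs_of_pos (by linarith), mem_sphere_zero_iff_norm] at hz
    have := h z (hz ▸ hs)
    rwa [hz] at this
  have hn := neg_abs_le (circleMean f 1)
  have hm1 : |circleMean f 1| ≤ |circleMean f 1| * r ^ σ :=
    le_mul_of_one_le_right (abs_nonneg _) hrσ
  have habs := abs_nonneg (circleMean f 1)
  constructor
  · have h1 := zeroNum_mul_log_le hf.entire hf.ne_zero hr (R := 2 * r) (by linarith)
    rw [mul_div_cancel_right₀ _ hr0.ne'] at h1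
    have h2 := hmean (2 * r) (by linarith)
    rw [mul_rpow (by norm_num) hr0.le] at h2
    have h3 : zeroNum f r ≤ (A * 2 ^ σ + |circleMean f 1|) / log 2 * r ^ σ := by
      rw [div_mul_eq_mul_div, le_div_iff₀ hl2, add_mul]
      linarith
    refine h3.trans ?_
    gcongr
    have : 0 ≤ 2 * A + |circleMean f 1| := by positivity
    linarith
  · rw [circleAverage_abs_log hf.entire]
    have h1 := hpos r hr
    have h2 := circleMean_mono hf.entire hf.ne_zero hr
    have h3 : 0 ≤ (A * 2 ^ σ + |circleMean f 1|) / log 2 * r ^ σ := by positivity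
    nlinarith

/-! ### Sums over the zeros -/

lemma absTail_eq_tsum_indicator (f : ℂ → ℂ) (m : ℕ) (R : ℝ) :
    absTail f m R = ∑' w : ℂ, {w : ℂ | w ≠ 0 ∧ R ≤ ‖w‖}.indicator
      (fun w => ENNReal.ofReal ((mult f w : ℝ) / ‖w‖ ^ m)) w :=
  tsum_subtype {w : ℂ | w ≠ 0 ∧ R ≤ ‖w‖} fun w => ENNReal.ofReal ((mult f w : ℝ) / ‖w‖ ^ m)

lemma signedTail_eq_tsum_indicator (f : ℂ → ℂ) (l : ℕ) (R : ℝ) :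
    signedTail f l R = ∑' w : ℂ, {w : ℂ | w ≠ 0 ∧ R ≤ ‖w‖}.indicator
      (fun w => (mult f w : ℂ) / w ^ l) w :=
  tsum_subtype {w : ℂ | w ≠ 0 ∧ R ≤ ‖w‖} fun w => (mult f w : ℂ) / w ^ l

lemma absTail_antitone (f : ℂ → ℂ) (m : ℕ) {r R : ℝ} (h : r ≤ R) :
    absTail f m R ≤ absTail f m r := by
  rw [absTail_eq_tsum_indicator, absTail_eq_tsum_indicator]
  have hsub : {w : ℂ | w ≠ 0 ∧ R ≤ ‖w‖} ⊆ {w : ℂ | w ≠ 0 ∧ r ≤ ‖w‖} :=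
    fun w hw => ⟨hw.1, h.trans hw.2⟩
  exact ENNReal.tsum_le_tsum fun w =>
    Set.indicator_le_indicator_of_subset hsub (fun _ => zero_le) w

/-- Multiplied by `R ^ m`, the tail is the sum of `(R / |w|) ^ m`, which decreases with `m`. -/
lemma absTail_mul_pow_le (f : ℂ → ℂ) {m l : ℕ} (hml : m ≤ l) {R : ℝ} (hR : 0 < R) :
    absTail f l R * ENNReal.ofReal (R ^ l) ≤ absTail f m R * ENNReal.ofReal (R ^ m) := by
  unfold absTail
  rw [← ENNReal.tsum_mul_right, ← ENNReal.tsum_mul_right]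
  refine ENNReal.tsum_le_tsum fun w => ?_
  rw [← ENNReal.ofReal_mul (by positivity), ← ENNReal.ofReal_mul (by positivity)]
  refine ENNReal.ofReal_le_ofReal ?_
  have hw : 0 < ‖(w : ℂ)‖ := hR.trans_le w.2.2
  rw [div_mul_eq_mul_div, div_mul_eq_mul_div, mul_div_assoc, mul_div_assoc, ← div_pow, ← div_pow]
  refine mul_le_mul_of_nonneg_left ?_ (Nat.cast_nonneg _)
  exact pow_le_pow_of_le_one (by positivity) ((div_le_one hw).2 w.2.2) hml

lemma ofReal_zeroNum (f : ℂ → ℂ) (R : ℝ) :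
    ENNReal.ofReal (zeroNum f R) = ∑ w ∈ zeroFinset f R, (mult f w : ℝ≥0∞) := by
  rw [zeroNum, ENNReal.ofReal_sum_of_nonneg fun _ _ => Nat.cast_nonneg _]
  simp

/-- The zeros of modulus at least one are split into dyadic annuli. -/
lemma IsGenusZero.absTail_one_one_lt_top {f : ℂ → ℂ} (hf : IsGenusZero f) :
    absTail f 1 1 < ⊤ := by
  obtain ⟨σ, hσ0, hσ1, C, hC, hgrow⟩ := hf.exists_growth
  set F : ℂ → ℝ≥0∞ := fun w => ENNReal.ofReal ((mult f w : ℝ) / ‖w‖ ^ 1) with hF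
  set S : ℕ → Set ℂ := fun i => {w | (2 : ℝ) ^ i ≤ ‖w‖ ∧ ‖w‖ ≤ 2 ^ (i + 1)} with hS
  have h1 : absTail f 1 1 ≤ ∑' w : ℂ, ∑' i : ℕ, (S i).indicator F w := by
    rw [absTail_eq_tsum_indicator]
    refine ENNReal.tsum_le_tsum fun w => Set.indicator_apply_le' (fun hw => ?_) (fun _ => zero_le)
    obtain ⟨i, hi, hi'⟩ := exists_nat_pow_near hw.2 (one_lt_two (α := ℝ))
    refine le_trans ?_ (ENNReal.le_tsum i)
    rw [Set.indicator_of_mem (show w ∈ S i from ⟨hi, hi'.le⟩)]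
  have h2 : ∀ i : ℕ, ∑' w : ℂ, (S i).indicator F w ≤
      ENNReal.ofReal (C * 2 ^ σ * (2 ^ (σ - 1)) ^ i) := by
    intro i
    have hsupp : ∀ w, w ∉ zeroFinset f (2 ^ (i + 1)) → (S i).indicator F w = 0 := by
      intro w hw
      by_cases hwS : w ∈ S i
      · have : mult f w = 0 := by
          by_contra h
          exact hw ((mem_zeroFinset hf.entire hf.ne_zero).2
            ⟨hwS.2, (mult_ne_zero_iff hf.entire hf.ne_zero w).1 h⟩)
        rw [Set.indicator_of_mem hwS, hF]
        simp [this]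
      · exact Set.indicator_of_notMem hwS _
    rw [tsum_eq_sum fun w hw => hsupp w hw]
    calc ∑ w ∈ zeroFinset f (2 ^ (i + 1)), (S i).indicator F w
        ≤ ∑ w ∈ zeroFinset f (2 ^ (i + 1)), ENNReal.ofReal ((mult f w : ℝ) / 2 ^ i) := by
          refine Finset.sum_le_sum fun w _ =>
            Set.indicator_apply_le' (fun hw => ?_) (fun _ => zero_le)
          simp only [hF, pow_one]
          refine ENNReal.ofReal_le_ofReal ?_
          gcongr
          exact hw.1
      _ = ENNReal.ofReal (zeroNum f (2 ^ (i + 1)) / 2 ^ i) := by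
          rw [← ENNReal.ofReal_sum_of_nonneg fun _ _ => by positivity, ← Finset.sum_div]
          rfl
      _ ≤ _ := by
          refine ENNReal.ofReal_le_ofReal ?_
          have := (hgrow (2 ^ (i + 1)) (one_le_pow₀ one_le_two)).1
          rw [div_le_iff₀ (by positivity)]
          refine this.trans_eq ?_
          rw [mul_assoc, mul_assoc, ← mul_pow, rpow_sub_one two_ne_zero,
            div_mul_cancel₀ _ two_ne_zero, ← rpow_natCast, ← rpow_natCast, ← rpow_mul zero_le_two, ← rpow_mul zero_le_two,
            ← rpow_add two_pos]
          congr 2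
          push_cast
          ring
  refine h1.trans_lt ?_
  rw [ENNReal.tsum_comm]
  refine (ENNReal.tsum_le_tsum h2).trans_lt ?_
  have hq : (2 : ℝ) ^ (σ - 1) < 1 := rpow_lt_one_of_one_lt_of_neg one_lt_two (by linarith)
  have hsum : Summable fun i : ℕ => C * 2 ^ σ * ((2 : ℝ) ^ (σ - 1)) ^ i :=
    (summable_geometric_of_lt_one (by positivity) hq).mul_left _
  exact hsum.tsum_ofReal_lt_top

lemma IsGenusZero.absTail_lt_top {f : ℂ → ℂ} (hf : IsGenusZero f) {m : ℕ} (hm : 1 ≤ m) (R : ℝ) :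
    absTail f m R < ⊤ := by
  set F : ℂ → ℝ≥0∞ := fun w => ENNReal.ofReal ((mult f w : ℝ) / ‖w‖ ^ m) with hF
  have h1 : absTail f m 1 < ⊤ := by
    have := absTail_mul_pow_le f hm one_pos
    simp only [one_pow, ENNReal.ofReal_one, mul_one] at this
    exact this.trans_lt hf.absTail_one_one_lt_top
  have h2 : absTail f m R ≤ ∑ w ∈ zeroFinset f 1, F w + absTail f m 1 := by
    have e : ∑ w ∈ zeroFinset f 1, F w =
        ∑' w : ℂ, (zeroFinset f 1 : Set ℂ).indicator F w := by
      rw [tsum_eq_sum (s := zeroFinset f 1)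
        (fun w hw => Set.indicator_of_notMem (by simpa using hw) _)]
      exact Finset.sum_congr rfl fun w hw => (Set.indicator_of_mem (by simpa using hw) _).symm
    rw [e, absTail_eq_tsum_indicator, absTail_eq_tsum_indicator, ← ENNReal.tsum_add]
    refine ENNReal.tsum_le_tsum fun w => ?_
    refine Set.indicator_apply_le' (fun hw => ?_) (fun _ => zero_le)
    by_cases hm0 : mult f w = 0
    · simp [hm0]
    · rcases le_total 1 ‖w‖ with h | h
      · rw [Set.indicator_of_mem (show w ∈ {w : ℂ | w ≠ 0 ∧ 1 ≤ ‖w‖} from ⟨hw.1, h⟩)]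
        exact le_add_self
      · rw [Set.indicator_of_mem (show w ∈ (zeroFinset f 1 : Set ℂ) from
          (mem_zeroFinset hf.entire hf.ne_zero).2
            ⟨h, (mult_ne_zero_iff hf.entire hf.ne_zero w).1 hm0⟩)]
        exact le_self_add
  refine h2.trans_lt (ENNReal.add_lt_top.2 ⟨?_, h1⟩)
  exact ENNReal.sum_lt_top.2 fun w _ => ENNReal.ofReal_lt_top

lemma IsGenusZero.summable_norm_signedTail {f : ℂ → ℂ} (hf : IsGenusZero f) {l : ℕ} (hl : 1 ≤ l)
    (R : ℝ) : Summable fun w : ℂ => {w : ℂ | w ≠ 0 ∧ R ≤ ‖w‖}.indicator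
      (fun w => (mult f w : ℝ) / ‖w‖ ^ l) w := by
  have h := hf.absTail_lt_top hl R
  rw [absTail_eq_tsum_indicator] at h
  have := ENNReal.summable_toReal h.ne
  refine this.congr fun w => ?_
  by_cases hw : w ∈ {w : ℂ | w ≠ 0 ∧ R ≤ ‖w‖}
  · rw [Set.indicator_of_mem hw, Set.indicator_of_mem hw, ENNReal.toReal_ofReal (by positivity)]
  · rw [Set.indicator_of_notMem hw, Set.indicator_of_notMem hw, ENNReal.toReal_zero]

lemma norm_indicator_zeroTerm (f : ℂ → ℂ) (l : ℕ) (s : Set ℂ) (w : ℂ) :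
    ‖s.indicator (fun w => (mult f w : ℂ) / w ^ l) w‖ =
      s.indicator (fun w => (mult f w : ℝ) / ‖w‖ ^ l) w := by
  rw [norm_indicator_eq_indicator_norm]
  simp

lemma IsGenusZero.norm_signedTail_le {f : ℂ → ℂ} (hf : IsGenusZero f) {l : ℕ} (hl : 1 ≤ l)
    (R : ℝ) : ‖signedTail f l R‖ ≤ (absTail f l R).toReal := by
  have hs := hf.summable_norm_signedTail hl R
  rw [signedTail_eq_tsum_indicator, absTail_eq_tsum_indicator, ENNReal.tsum_toReal_eq]
  · refine (norm_tsum_le_tsum_norm ?_).trans_eq (tsum_congr fun w => ?_)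
    · simpa only [norm_indicator_zeroTerm] using hs
    · rw [norm_indicator_zeroTerm]
      by_cases hw : w ∈ {w : ℂ | w ≠ 0 ∧ R ≤ ‖w‖}
      · rw [Set.indicator_of_mem hw, Set.indicator_of_mem hw, ENNReal.toReal_ofReal (by positivity)]
      · rw [Set.indicator_of_notMem hw, Set.indicator_of_notMem hw, ENNReal.toReal_zero]
  · intro w
    by_cases hw : w ∈ {w : ℂ | w ≠ 0 ∧ R ≤ ‖w‖}
    · rw [Set.indicator_of_mem hw]; exact ENNReal.ofReal_ne_top
    · rw [Set.indicator_of_notMem hw]; exact ENNReal.zero_ne_top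

/-- Truncations of the sum defining `signedTail` are finite sums over zeros. -/
lemma tsum_indicator_truncated {f : ℂ → ℂ} (hf : Differentiable ℂ f) (h0 : f ≠ 0) {l : ℕ}
    {r : ℝ} (hr : 0 < r) {R : ℝ} :
    ∑' w : ℂ, {w : ℂ | (w ≠ 0 ∧ r ≤ ‖w‖) ∧ ‖w‖ ≤ R}.indicator (fun w => (mult f w : ℂ) / w ^ l) w =
      ∑ w ∈ zeroFinset f R with r ≤ ‖w‖, (mult f w : ℂ) / w ^ l := by
  rw [tsum_eq_sum (s := (zeroFinset f R).filter (fun w => r ≤ ‖w‖))]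
  · refine Finset.sum_congr rfl fun w hw => ?_
    rw [Finset.mem_filter, mem_zeroFinset hf h0] at hw
    rw [Set.indicator_of_mem]
    exact ⟨⟨norm_pos_iff.1 (hr.trans_le hw.2), hw.2⟩, hw.1.1⟩
  · intro w hw
    rw [Finset.mem_filter, mem_zeroFinset hf h0] at hw
    by_cases h : w ∈ {w : ℂ | (w ≠ 0 ∧ r ≤ ‖w‖) ∧ ‖w‖ ≤ R}
    · have : mult f w = 0 := by
        by_contra hm
        exact hw ⟨⟨h.2, (mult_ne_zero_iff hf h0 w).1 hm⟩, h.1.2⟩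
      rw [Set.indicator_of_mem h, this]
      simp
    · exact Set.indicator_of_notMem h _

lemma IsGenusZero.tendsto_sum_zeroFinset {f : ℂ → ℂ} (hf : IsGenusZero f) {l : ℕ} (hl : 1 ≤ l)
    {r : ℝ} (hr : 0 < r) :
    Tendsto (fun R : ℝ => ∑ w ∈ zeroFinset f R with r ≤ ‖w‖, (mult f w : ℂ) / w ^ l) atTop
      (𝓝 (signedTail f l r)) := by
  simp_rw [← tsum_indicator_truncated hf.entire hf.ne_zero hr]
  rw [signedTail_eq_tsum_indicator]
  refine tendsto_tsum_of_dominated_convergence (hf.summable_norm_signedTail hl r) ?_ ?_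
  · intro w
    refine tendsto_const_nhds.congr' ?_
    filter_upwards [eventually_ge_atTop ‖w‖] with R hR
    by_cases h : w ∈ {w : ℂ | w ≠ 0 ∧ r ≤ ‖w‖}
    · rw [Set.indicator_of_mem h, Set.indicator_of_mem
        (show w ∈ {w : ℂ | (w ≠ 0 ∧ r ≤ ‖w‖) ∧ ‖w‖ ≤ R} from ⟨h, hR⟩)]
    · rw [Set.indicator_of_notMem h, Set.indicator_of_notMem fun h' => h h'.1]
  · refine Eventually.of_forall fun R w => ?_
    rw [norm_indicator_zeroTerm]
    exact Set.indicator_le_indicator_of_subset (fun w hw => hw.1) (fun _ => by positivity) w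

/-- The sums over the zeros outside two discs differ by a sum over the zeros in between. -/
lemma IsGenusZero.norm_signedTail_le_add {f : ℂ → ℂ} (hf : IsGenusZero f) {l : ℕ} (hl : 1 ≤ l)
    {r R : ℝ} (hr : 0 < r) (hrR : r ≤ R) :
    ‖signedTail f l R‖ ≤ ‖signedTail f l r‖ + zeroNum f R / r ^ l := by
  classical
  have hR : 0 < R := hr.trans_le hrR
  have h := (hf.tendsto_sum_zeroFinset hl hR).norm
  have h2 := ((hf.tendsto_sum_zeroFinset hl hr).norm).add_const (zeroNum f R / r ^ l)
  refine le_of_tendsto_of_tendsto h h2 ?_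
  filter_upwards [eventually_ge_atTop R] with s hs
  have hsub : (zeroFinset f s).filter (fun w => R ≤ ‖w‖) ⊆
      (zeroFinset f s).filter (fun w => r ≤ ‖w‖) := fun w hw => by
    rw [Finset.mem_filter] at hw ⊢
    exact ⟨hw.1, hrR.trans hw.2⟩
  have e := Finset.sum_sdiff hsub (f := fun w => (mult f w : ℂ) / w ^ l)
  rw [← e]
  set D := (zeroFinset f s).filter (fun w => r ≤ ‖w‖) \ (zeroFinset f s).filter (fun w => R ≤ ‖w‖)
  have hD : ‖∑ w ∈ D, (mult f w : ℂ) / w ^ l‖ ≤ zeroNum f R / r ^ l := by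
    refine (norm_sum_le _ _).trans ?_
    rw [zeroNum, Finset.sum_div]
    have hmem : ∀ w ∈ D, w ∈ zeroFinset f R ∧ r ≤ ‖w‖ := by
      intro w hw
      simp only [D, Finset.mem_sdiff, Finset.mem_filter, mem_zeroFinset hf.entire hf.ne_zero,
        not_and, not_le] at hw
      rw [mem_zeroFinset hf.entire hf.ne_zero]
      exact ⟨⟨(hw.2 hw.1.1).le, hw.1.1.2⟩, hw.1.2⟩
    refine (Finset.sum_le_sum fun w hw => ?_).trans
      (Finset.sum_le_sum_of_subset_of_nonneg (fun w hw => (hmem w hw).1)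
        fun _ _ _ => by positivity)
    rw [norm_div, norm_pow, Complex.norm_natCast]
    gcongr
    exact (hmem w hw).2
  set A := ∑ w ∈ D, (mult f w : ℂ) / w ^ l
  set B := ∑ w ∈ zeroFinset f s with R ≤ ‖w‖, (mult f w : ℂ) / w ^ l
  have : ‖B‖ ≤ ‖A + B‖ + ‖A‖ := by
    have := norm_sub_le (A + B) A
    rwa [add_sub_cancel_left] at this
  linarith

/-- The zeros between the two radii `r` and `R` contribute at least `R ^ (-m)` each to the tail. -/
lemma IsGenusZero.zeroNum_le_add_absTail {f : ℂ → ℂ} (hf : IsGenusZero f) {m : ℕ} (hm : 1 ≤ m)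
    {r R : ℝ} (hr : 0 < r) (hrR : r ≤ R) :
    zeroNum f R ≤ zeroNum f r + R ^ m * (absTail f m r).toReal := by
  classical
  have hR : 0 < R := hr.trans_le hrR
  have hsub : zeroFinset f r ⊆ zeroFinset f R := fun w hw => by
    rw [mem_zeroFinset hf.entire hf.ne_zero] at hw ⊢
    exact ⟨hw.1.trans hrR, hw.2⟩
  unfold zeroNum
  rw [← Finset.sum_sdiff hsub, add_comm]
  gcongr
  set D := zeroFinset f R \ zeroFinset f r
  have hD : ∀ w ∈ D, r ≤ ‖w‖ ∧ ‖w‖ ≤ R := by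
    intro w hw
    simp only [D, Finset.mem_sdiff, mem_zeroFinset hf.entire hf.ne_zero, not_and] at hw
    exact ⟨le_of_lt (not_le.1 fun h => hw.2 h hw.1.2), hw.1.1⟩
  have h1 : ENNReal.ofReal (∑ w ∈ D, (mult f w : ℝ) / ‖w‖ ^ m) ≤ absTail f m r := by
    rw [ENNReal.ofReal_sum_of_nonneg fun _ _ => by positivity, absTail_eq_tsum_indicator]
    refine le_trans ?_ (ENNReal.sum_le_tsum D)
    refine Finset.sum_le_sum fun w hw => ?_
    rw [Set.indicator_of_mem]
    exact ⟨norm_pos_iff.1 (hr.trans_le (hD w hw).1), (hD w hw).1⟩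
  have h2 := (ENNReal.ofReal_le_iff_le_toReal (hf.absTail_lt_top hm r).ne).1 h1
  refine le_trans ?_ (mul_le_mul_of_nonneg_left h2 (by positivity))
  rw [Finset.mul_sum]
  refine Finset.sum_le_sum fun w hw => ?_
  have hw0 : 0 < ‖w‖ := hr.trans_le (hD w hw).1
  rw [mul_div_assoc', le_div_iff₀ (by positivity), mul_comm]
  gcongr
  exact (hD w hw).2

/-! ### The Fourier coefficients of `log |f|` in terms of the zeros -/

lemma exists_radius_avoiding_zeros {P : ℕ → ℂ → ℂ} (hP : ∀ n, Differentiable ℂ (P n))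
    (h0 : ∀ n, P n ≠ 0) {a b : ℝ} (hab : a < b) :
    ∃ r, a < r ∧ r < b ∧ ∀ n z, ‖z‖ = r → P n z ≠ 0 := by
  have hc : (⋃ n : ℕ, ⋃ j : ℕ, (norm '' {w : ℂ | ‖w‖ ≤ j ∧ P n w = 0})).Countable :=
    Set.countable_iUnion fun n => Set.countable_iUnion fun j =>
      ((finite_zeros (hP n) (h0 n) j).image _).countable
  obtain ⟨r, hr, hra, hrb⟩ := (hc.dense_compl ℝ).exists_between hab
  refine ⟨r, hra, hrb, fun n z hz h => hr ?_⟩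
  obtain ⟨j, hj⟩ := exists_nat_ge ‖z‖
  exact Set.mem_iUnion.2 ⟨n, Set.mem_iUnion.2 ⟨j, z, ⟨hj, h⟩, hz⟩⟩

lemma norm_sum_zeroFinset_le {f : ℂ → ℂ} (hf : Differentiable ℂ f) (h0 : f ≠ 0) {r : ℝ}
    (hr : 0 < r) (l : ℕ) :
    ‖∑ w ∈ zeroFinset f r, (mult f w : ℂ) * (conj w / r) ^ l‖ ≤ zeroNum f r := by
  refine (norm_sum_le _ _).trans (Finset.sum_le_sum fun w hw => ?_)
  rw [mem_zeroFinset hf h0] at hw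
  rw [norm_mul, Complex.norm_natCast, norm_pow, norm_div, Complex.norm_conj, Complex.norm_real,
    norm_of_nonneg hr.le]
  refine mul_le_of_le_one_right (Nat.cast_nonneg _) (pow_le_one₀ (by positivity) ?_)
  exact (div_le_one hr).2 hw.1

/-- The Fourier coefficients of `log |f|` for `f` of genus zero. They involve only the zeros: the
contribution of a larger circle, of radius `R`, is `o(R)` and is weighted by `(r / R) ^ l`. This
replaces the product expansion of `f`. -/
lemma IsGenusZero.circleCoeff_log {f : ℂ → ℂ} (hf : IsGenusZero f) {r : ℝ} (hr : 0 < r)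
    (hgen : ∀ z, ‖z‖ = r → f z ≠ 0) {l : ℕ} (hl : 1 ≤ l) :
    circleCoeff (fun z => log ‖f z‖) r l =
      -(1 / (2 * l)) * (∑ w ∈ zeroFinset f r, (mult f w : ℂ) * (conj w / r) ^ l +
        (r : ℂ) ^ l * signedTail f l r) := by
  obtain ⟨σ, hσ0, hσ1, C, hC, hgrow⟩ := hf.exists_growth
  choose ρ hρ1 hρ2 hρ using fun i : ℕ => exists_radius_avoiding_zeros (P := fun _ => f)
    (fun _ => hf.entire) (fun _ => hf.ne_zero) (show max r 1 + i < max r 1 + i + 1 by linarith)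
  have hρr : ∀ i, r < ρ i := fun i => by
    have := hρ1 i
    have := le_max_left r 1
    have : (0 : ℝ) ≤ i := Nat.cast_nonneg i
    linarith
  have hρone : ∀ i, 1 ≤ ρ i := fun i => by
    have := hρ1 i
    have := le_max_right r 1
    have : (0 : ℝ) ≤ i := Nat.cast_nonneg i
    linarith
  have hρtop : Tendsto ρ atTop atTop :=
    tendsto_atTop_mono (fun i => by
      have := hρ1 i
      have := le_max_right r 1
      linarith) tendsto_natCast_atTop_atTop
  -- The contribution of the circle of radius `ρ i`.
  set E : ℕ → ℂ := fun i => (r / ρ i : ℂ) ^ l * (circleCoeff (fun z => log ‖f z‖) (ρ i) l +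
        (1 / (2 * l)) * ∑ w ∈ zeroFinset f (ρ i), (mult f w : ℂ) * (conj w / ρ i) ^ l) with hE
  have hE0 : Tendsto E atTop (𝓝 0) := by
    have hlim : Tendsto (fun i => r ^ l * (2 * C) * (ρ i) ^ (-(1 - σ))) atTop (𝓝 0) := by
      have := ((tendsto_rpow_neg_atTop (sub_pos.2 hσ1)).comp hρtop).const_mul (r ^ l * (2 * C))
      simpa using this
    refine squeeze_zero_norm (fun i => ?_) hlim
    have hρ0 : 0 < ρ i := by linarith [hρone i]
    have h1 := (norm_circleCoeff_le (u := fun z => log ‖f z‖) hρ0 l).trans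
      (hgrow (ρ i) (hρone i)).2
    have h2 := (norm_sum_zeroFinset_le hf.entire hf.ne_zero hρ0 l).trans
      (hgrow (ρ i) (hρone i)).1
    have hl' : (1 : ℝ) ≤ l := by exact_mod_cast hl
    have h3 : ‖(1 / (2 * l) : ℂ)‖ ≤ 1 := by
      rw [norm_div, norm_one, norm_mul, Complex.norm_natCast, Complex.norm_ofNat]
      rw [div_le_one (by positivity)]
      linarith
    have h4 : ‖(r / ρ i : ℂ) ^ l‖ ≤ r ^ l * (ρ i)⁻¹ := by
      rw [norm_pow, norm_div, Complex.norm_real, Complex.norm_real, norm_of_nonneg hr.le,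
        norm_of_nonneg hρ0.le, div_pow, div_eq_mul_inv]
      gcongr
      exact le_self_pow₀ (hρone i) (by omega)
    have h5 : (ρ i) ^ (-(1 - σ)) = (ρ i) ^ σ * (ρ i)⁻¹ := by
      rw [← rpow_neg_one, ← rpow_add hρ0]; congr 1; ring
    rw [hE, norm_mul, h5]
    calc _ ≤ (r ^ l * (ρ i)⁻¹) * (C * (ρ i) ^ σ + 1 * (C * (ρ i) ^ σ)) := by
          gcongr
          refine (norm_add_le _ _).trans ?_
          rw [norm_mul]
          gcongr
      _ = _ := by ring
  have hmain : ∀ i, circleCoeff (fun z => log ‖f z‖) r l =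
      -(1 / (2 * l)) * (∑ w ∈ zeroFinset f r, (mult f w : ℂ) * (conj w / r) ^ l +
        (r : ℂ) ^ l * ∑ w ∈ zeroFinset f (ρ i) with r ≤ ‖w‖, (mult f w : ℂ) / w ^ l) + E i := by
    intro i
    rw [circleCoeff_log_two_radii hf.entire hf.ne_zero hr (hρr i) hgen (hρ i 0) hl, hE]
    congr 3
    rw [Finset.mul_sum]
    refine Finset.sum_congr rfl fun w _ => ?_
    rw [div_pow]
    ring
  have hlim := (((((hf.tendsto_sum_zeroFinset hl hr).comp hρtop).const_mul ((r : ℂ) ^ l)).const_add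
    (∑ w ∈ zeroFinset f r, (mult f w : ℂ) * (conj w / r) ^ l)).const_mul
      (-(1 / (2 * l)) : ℂ)).add hE0
  rw [add_zero] at hlim
  refine tendsto_nhds_unique (tendsto_const_nhds.congr hmain) hlim

lemma IsGenusZero.norm_circleCoeff_log_le {f : ℂ → ℂ} (hf : IsGenusZero f) {r : ℝ} (hr : 0 < r)
    (hgen : ∀ z, ‖z‖ = r → f z ≠ 0) {l : ℕ} (hl : 1 ≤ l) :
    ‖circleCoeff (fun z => log ‖f z‖) r l‖ * l ≤
      zeroNum f r + r ^ l * (absTail f l r).toReal := by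
  have hl0 : (0 : ℝ) < l := by exact_mod_cast hl
  have h1 := norm_sum_zeroFinset_le hf.entire hf.ne_zero hr l
  have h2 := hf.norm_signedTail_le hl r
  rw [hf.circleCoeff_log hr hgen hl, norm_mul, norm_neg, norm_div, norm_one, norm_mul,
    Complex.norm_ofNat, Complex.norm_natCast]
  have h3 : ‖∑ w ∈ zeroFinset f r, (mult f w : ℂ) * (conj w / r) ^ l +
        (r : ℂ) ^ l * signedTail f l r‖ ≤ zeroNum f r + r ^ l * (absTail f l r).toReal := by
    refine (norm_add_le _ _).trans ?_
    rw [norm_mul, norm_pow, Complex.norm_real, norm_of_nonneg hr.le]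
    gcongr
  have h4 : (1 / (2 * (l : ℝ))) * l = 1 / 2 := by field_simp
  have h5 := norm_nonneg (∑ w ∈ zeroFinset f r, (mult f w : ℂ) * (conj w / r) ^ l +
        (r : ℂ) ^ l * signedTail f l r)
  rw [mul_right_comm, h4]
  linarith

lemma IsGenusZero.pow_mul_norm_signedTail_le {f : ℂ → ℂ} (hf : IsGenusZero f) {r : ℝ} (hr : 0 < r)
    (hgen : ∀ z, ‖z‖ = r → f z ≠ 0) {l : ℕ} (hl : 1 ≤ l) :
    r ^ l * ‖signedTail f l r‖ ≤
      2 * l * ‖circleCoeff (fun z => log ‖f z‖) r l‖ + zeroNum f r := by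
  have hl0 : (l : ℂ) ≠ 0 := by exact_mod_cast (show l ≠ 0 by omega)
  have h1 := norm_sum_zeroFinset_le hf.entire hf.ne_zero hr l
  have h2 := hf.circleCoeff_log hr hgen hl
  have h3 : (r : ℂ) ^ l * signedTail f l r =
      -(2 * l * circleCoeff (fun z => log ‖f z‖) r l +
        ∑ w ∈ zeroFinset f r, (mult f w : ℂ) * (conj w / r) ^ l) := by
    rw [h2]; field_simp; ring
  have h4 : ‖(r : ℂ) ^ l * signedTail f l r‖ = r ^ l * ‖signedTail f l r‖ := by
    rw [norm_mul, norm_pow, Complex.norm_real, norm_of_nonneg hr.le]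
  rw [← h4, h3, norm_neg]
  refine (norm_add_le _ _).trans ?_
  rw [norm_mul, norm_mul, Complex.norm_ofNat, Complex.norm_natCast]
  gcongr

/-! ### An `L²` bound from the decay of the Fourier coefficients -/

lemma fourier_smul_eq_circleCoeff_integrand {r : ℝ} (hr : 0 < r) (u : ℂ → ℝ) (l : ℕ) (θ : ℝ) :
    fourier (-(l : ℤ)) (θ : AddCircle (2 * π - 0)) • (u (circleMap 0 r θ) : ℂ) =
      (u (circleMap 0 r θ) : ℂ) * ((r : ℂ) / circleMap 0 r θ) ^ l := by
  have hrC : (r : ℂ) ≠ 0 := by exact_mod_cast hr.ne'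
  have hπ : (π : ℂ) ≠ 0 := by exact_mod_cast pi_ne_zero
  rw [fourier_coe_apply, smul_eq_mul, mul_comm, circleMap, zero_add, div_mul_cancel_left₀ hrC,
    ← Complex.exp_neg, ← Complex.exp_nat_mul]
  congr 2
  push_cast
  rw [sub_zero]
  field_simp

lemma fourierCoeffOn_eq_circleCoeff {r : ℝ} (hr : 0 < r) (u : ℂ → ℝ) (l : ℕ) :
    fourierCoeffOn two_pi_pos (fun θ => (u (circleMap 0 r θ) : ℂ)) l = circleCoeff u r l := by
  rw [fourierCoeffOn_eq_integral]
  simp_rw [fourier_smul_eq_circleCoeff_integrand hr]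
  rw [circleCoeff, circleAverage, sub_zero, one_div]

lemma norm_fourierCoeffOn_neg (φ : ℝ → ℝ) (n : ℤ) :
    ‖fourierCoeffOn two_pi_pos (fun θ => (φ θ : ℂ)) (-n)‖ =
      ‖fourierCoeffOn two_pi_pos (fun θ => (φ θ : ℂ)) n‖ := by
  rw [fourierCoeffOn_eq_integral, fourierCoeffOn_eq_integral, norm_smul, norm_smul]
  congr 1
  rw [← Complex.norm_conj (∫ x in (0 : ℝ)..2 * π, _)]
  congr 1
  rw [intervalIntegral.integral_of_le two_pi_pos.le, intervalIntegral.integral_of_le two_pi_pos.le,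
    ← integral_conj]
  congr 1
  funext θ
  simp only [smul_eq_mul, map_mul, Complex.conj_ofReal]
  rw [← fourier_neg, neg_neg]

/-- Parseval's identity, with coefficients of size `D / l`; the constant comes from
`2 * ∑ 1 / l ^ 2 ≤ 4`. -/
lemma circleAverage_sq_le_of_circleCoeff_le {u : ℂ → ℝ} {r : ℝ} (hr : 0 < r)
    (hu : ContinuousOn u (sphere 0 r)) {D : ℝ}
    (hD : ∀ l : ℕ, 1 ≤ l → ‖circleCoeff u r l‖ * l ≤ D) :
    circleAverage (fun z => u z ^ 2) 0 r ≤ circleAverage u 0 r ^ 2 + 4 * D ^ 2 := by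
  set φ : ℝ → ℂ := fun θ => (u (circleMap 0 r θ) : ℂ) with hφ
  have hcont : Continuous φ := Complex.continuous_ofReal.comp
    (hu.comp_continuous (continuous_circleMap 0 r) fun θ => by simp [abs_of_pos hr])
  have hL2 : MeasureTheory.MemLp φ 2 (MeasureTheory.volume.restrict (Set.Ioc 0 (2 * π))) := by
    obtain ⟨B, hB⟩ := isCompact_Icc.exists_bound_of_continuousOn
      (hcont.continuousOn (s := Set.Icc 0 (2 * π)))
    refine MeasureTheory.MemLp.of_bound hcont.aestronglyMeasurable B ?_
    filter_upwards [MeasureTheory.ae_restrict_mem measurableSet_Ioc] with θ hθ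
    exact hB θ (Set.Ioc_subset_Icc_self hθ)
  have hP := (hasSum_sq_fourierCoeffOn two_pi_pos hL2).nat_add_neg
  have hq : (2 * π - 0)⁻¹ • ∫ x in (0 : ℝ)..2 * π, ‖φ x‖ ^ 2 =
      circleAverage (fun z => u z ^ 2) 0 r := by
    rw [circleAverage, sub_zero]
    congr 2
    funext θ
    rw [hφ, Complex.norm_real, norm_eq_abs, sq_abs]
  have hzero : ‖fourierCoeffOn two_pi_pos φ 0‖ ^ 2 = circleAverage u 0 r ^ 2 := by
    have h1 := fourierCoeffOn_eq_circleCoeff hr u 0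
    have h2 : circleCoeff u r 0 = ((circleAverage u 0 r : ℝ) : ℂ) := by
      unfold circleCoeff circleAverage
      simp only [pow_zero, mul_one]
      rw [intervalIntegral.integral_ofReal, smul_eq_mul, Complex.real_smul]
      push_cast; rfl
    rw [Nat.cast_zero] at h1
    rw [h1, h2, Complex.norm_real, norm_eq_abs, sq_abs]
  rw [hq, hzero] at hP
  have hg : HasSum (fun n : ℕ => (if n = 0 then 2 * circleAverage u 0 r ^ 2 else 0) +
      2 * D ^ 2 * (1 / (n : ℝ) ^ 2)) (2 * circleAverage u 0 r ^ 2 + 2 * D ^ 2 * (π ^ 2 / 6)) :=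
    (hasSum_ite_eq 0 _).add (hasSum_zeta_two.mul_left _)
  have hle := hasSum_le (fun n => ?_) hP hg
  · have hπ : π ^ 2 ≤ 12 := by nlinarith [pi_lt_d2, pi_pos]
    have := mul_le_mul_of_nonneg_left hπ (sq_nonneg D)
    linarith
  · have hneg := norm_fourierCoeffOn_neg (fun θ => u (circleMap 0 r θ)) (n : ℤ)
    rw [hneg]
    rcases Nat.eq_zero_or_pos n with rfl | hn
    · rw [Nat.cast_zero, hzero]
      simp
      linarith
    · rw [if_neg hn.ne', fourierCoeffOn_eq_circleCoeff hr]
      have hn' : (0 : ℝ) < n := by exact_mod_cast hn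
      have h1 : ‖circleCoeff u r n‖ ≤ D / n := (le_div_iff₀ hn').2 (hD n hn)
      have h2 : ‖circleCoeff u r n‖ ^ 2 ≤ (D / n) ^ 2 := by gcongr
      rw [div_pow] at h2
      rw [zero_add, mul_one_div, mul_div_assoc]
      linarith

lemma continuousOn_log_norm {f : ℂ → ℂ} (hf : Differentiable ℂ f) {r : ℝ}
    (hgen : ∀ z, ‖z‖ = r → f z ≠ 0) : ContinuousOn (fun z => log ‖f z‖) (sphere 0 r) :=
  hf.continuous.norm.continuousOn.log fun z hz =>
    norm_ne_zero_iff.2 (hgen z (by simpa using hz))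

/-- If the zeros outside a disc are controlled and the mean of `log |f|` is bounded below on the
unit circle, then the `L²` norm of `log |f|` on a larger circle is bounded by its `L¹` norm. For
small `l` the Fourier coefficients are bounded by the `L¹` norm, for large `l` by the
zeros, whose number inside the circle is again controlled by the `L¹` norm. -/
lemma IsGenusZero.sqrt_circleAverage_sq_le {f : ℂ → ℂ} (hf : IsGenusZero f) {r ρ : ℝ} (hr : 1 ≤ r)
    (hrρ : r < ρ) (hgen : ∀ z, ‖z‖ = ρ → f z ≠ 0) {m : ℕ} (hm : 1 ≤ m) {c K κ : ℝ}
    (hc : -(c * κ) ≤ circleMean f 1) (hK : (absTail f m r).toReal ≤ K * κ) :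
    √(circleAverage (fun z => log ‖f z‖ ^ 2) 0 ρ) ≤
      (1 + 2 * m + 2 / log (ρ / r)) * circleAverage (fun z => |log ‖f z‖|) 0 ρ +
        (2 * c / log (ρ / r) + 4 * ρ ^ m * K) * κ := by
  have hr0 : 0 < r := by linarith
  have hρ0 : 0 < ρ := hr0.trans hrρ
  set a := circleAverage (fun z => |log ‖f z‖|) 0 ρ with ha
  set L := log (ρ / r) with hL
  have hL0 : 0 < L := log_pos ((one_lt_div hr0).2 hrρ)
  have ha0 : 0 ≤ a := circleAverage_nonneg_of_nonneg fun z _ => abs_nonneg _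
  have hma : |circleMean f ρ| ≤ a := abs_circleAverage_le_circleAverage_abs
  have hN1 : zeroNum f r ≤ (a + c * κ) / L := by
    rw [le_div_iff₀ hL0]
    have := zeroNum_mul_log_le hf.entire hf.ne_zero hr hrρ.le
    have := le_abs_self (circleMean f ρ)
    linarith
  have hN2 : zeroNum f ρ ≤ (a + c * κ) / L + ρ ^ m * (K * κ) := by
    refine (hf.zeroNum_le_add_absTail hm hr0 hrρ.le).trans ?_
    gcongr
  set E := (a + c * κ) / L + ρ ^ m * (K * κ) + ρ ^ m * (K * κ) with hE
  have hKκ : 0 ≤ K * κ := ENNReal.toReal_nonneg.trans hK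
  have hE0 : 0 ≤ E := by
    have h1 := (zeroNum_nonneg f ρ).trans hN2
    have : 0 ≤ ρ ^ m * (K * κ) := by positivity
    linarith
  have hD : ∀ l : ℕ, 1 ≤ l → ‖circleCoeff (fun z => log ‖f z‖) ρ l‖ * l ≤ m * a + E := by
    intro l hl
    rcases le_total m l with h | h
    · have h1 := hf.norm_circleCoeff_log_le hρ0 hgen hl
      have h2 : ρ ^ l * (absTail f l ρ).toReal ≤ ρ ^ m * (K * κ) := by
        have h3 := absTail_mul_pow_le f h hρ0
        have h4 := ENNReal.toReal_mono
          (ENNReal.mul_ne_top (hf.absTail_lt_top hm ρ).ne ENNReal.ofReal_ne_top) h3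
        rw [ENNReal.toReal_mul, ENNReal.toReal_mul, ENNReal.toReal_ofReal (by positivity),
          ENNReal.toReal_ofReal (by positivity)] at h4
        have h5 := ENNReal.toReal_mono (hf.absTail_lt_top hm r).ne (absTail_antitone f m hrρ.le)
        have h6 : ρ ^ m * (absTail f m ρ).toReal ≤ ρ ^ m * (K * κ) := by
          gcongr
          exact h5.trans hK
        linarith
      have : 0 ≤ (m : ℝ) * a := by positivity
      linarith
    · have h1 := norm_circleCoeff_le (u := fun z => log ‖f z‖) hρ0 l
      have h2 : (l : ℝ) ≤ m := by exact_mod_cast h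
      have : ‖circleCoeff (fun z => log ‖f z‖) ρ l‖ * l ≤ a * m := by gcongr
      linarith
  have hq := circleAverage_sq_le_of_circleCoeff_le hρ0 (continuousOn_log_norm hf.entire hgen) hD
  have hsq : circleAverage (fun z => log ‖f z‖) 0 ρ ^ 2 ≤ a ^ 2 := by
    rw [← sq_abs]
    gcongr
    exact hma
  have hma0 : 0 ≤ (m : ℝ) * a := by positivity
  have h1 : √(circleAverage (fun z => log ‖f z‖ ^ 2) 0 ρ) ≤ a + 2 * (m * a + E) := by
    rw [sqrt_le_left (by linarith)]
    nlinarith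
  refine h1.trans_eq ?_
  rw [hE]
  ring

/-- A sequence that is bounded in `L²` and tends to zero pointwise tends to zero in `L¹`. -/
lemma tendsto_circleAverage_zero_of_sq_le {v : ℕ → ℂ → ℝ} {r : ℝ} (hr : 0 < r)
    (hv : ∀ n, ContinuousOn (v n) (sphere 0 r)) (hv0 : ∀ n z, 0 ≤ v n z)
    (hsq : ∀ n, circleAverage (fun z => v n z ^ 2) 0 r ≤ 1)
    (hlim : ∀ z, Tendsto (fun n => v n z) atTop (𝓝 0)) :
    Tendsto (fun n => circleAverage (v n) 0 r) atTop (𝓝 0) := by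
  have hint : ∀ w : ℂ → ℝ, ContinuousOn w (sphere 0 r) → CircleIntegrable w 0 r :=
    fun w hw => hw.circleIntegrable hr.le
  have hmincont : ∀ (M : ℝ) n, ContinuousOn (fun z => min (v n z) M) (sphere 0 r) :=
    fun M n => (hv n).inf continuousOn_const
  have hmin : ∀ M : ℝ, 0 ≤ M →
      Tendsto (fun n => circleAverage (fun z => min (v n z) M) 0 r) atTop (𝓝 0) := by
    intro M hM
    have h0 : (0 : ℝ) = circleAverage (fun _ : ℂ => (0 : ℝ)) 0 r := by simp [circleAverage]
    rw [h0]
    unfold circleAverage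
    refine Tendsto.const_smul ?_ _
    refine intervalIntegral.tendsto_integral_filter_of_dominated_convergence (fun _ => M)
      ?_ ?_ intervalIntegrable_const ?_
    · refine Eventually.of_forall fun n => ?_
      exact ((hmincont M n).comp_continuous (continuous_circleMap 0 r)
        fun θ => by simp [abs_of_pos hr]).aestronglyMeasurable
    · refine Eventually.of_forall fun n => Eventually.of_forall fun θ _ => ?_
      rw [norm_of_nonneg (le_min (hv0 _ _) hM)]
      exact min_le_right _ _
    · refine Eventually.of_forall fun θ _ => ?_
      have := (hlim (circleMap 0 r θ)).min (tendsto_const_nhds (x := M))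
      rwa [min_eq_left hM] at this
  -- Truncate at height `2 / ε`: above it, `v ≤ (ε / 2) * v ^ 2`.
  rw [Metric.tendsto_atTop]
  intro ε hε
  obtain ⟨N, hN⟩ := Metric.tendsto_atTop.1 (hmin (2 / ε) (by positivity)) (ε / 2) (by positivity)
  refine ⟨N, fun n hn => ?_⟩
  have h1 := hN n hn
  rw [dist_zero_right, norm_eq_abs] at h1 ⊢
  rw [abs_of_nonneg (circleAverage_nonneg_of_nonneg fun z _ => hv0 n z)]
  have h2 := le_abs_self (circleAverage (fun z => min (v n z) (2 / ε)) 0 r)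
  have hsqi : CircleIntegrable (fun z => (ε / 2) • v n z ^ 2) 0 r :=
    hint _ (by have := hv n; fun_prop)
  have h3 : circleAverage (v n) 0 r ≤
      circleAverage (fun z => min (v n z) (2 / ε) + (ε / 2) • v n z ^ 2) 0 r := by
    refine circleAverage_mono (hint _ (hv n)) ((hint _ (hmincont _ n)).add hsqi) fun z _ => ?_
    have hvz := hv0 n z
    rw [smul_eq_mul]
    rcases le_total (v n z) (2 / ε) with h | h
    · rw [min_eq_left h]
      have : 0 ≤ ε / 2 * v n z ^ 2 := by positivity
      linarith
    · rw [min_eq_right h]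
      have h4 : v n z ≤ ε / 2 * v n z ^ 2 := by
        rw [div_le_iff₀ hε] at h
        nlinarith
      have : 0 ≤ 2 / ε := by positivity
      linarith
  rw [circleAverage_fun_add (hint _ (hmincont _ n)) hsqi, circleAverage_fun_smul, smul_eq_mul] at h3
  have h4 := mul_le_mul_of_nonneg_left (hsq n) (show 0 ≤ ε / 2 by positivity)
  linarith

/-! ### Asymptotics along a sequence of functions -/

/-- The bootstrap. Normalise `log |P n|` by its `L²` norm (or by `k n`, if that is larger). The
positive parts then tend to zero in `L¹`, hence so do the full functions, up to the normalised
lower bound at the unit circle; since the `L²` norm is controlled by the `L¹` norm, the normalising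
factor is comparable to `k n`. -/
lemma eventually_circleAverage_abs_le {P : ℕ → ℂ → ℂ} {k : ℕ → ℝ} (hP : ∀ n, IsGenusZero (P n))
    (hk : ∀ n, 0 < k n) {c : ℝ} (hc : ∀ᶠ n in atTop, -(c * k n) ≤ circleMean (P n) 1)
    (hup : ∀ z : ℂ, ∀ ε > 0, ∀ᶠ n in atTop, log ‖P n z‖ ≤ ε * k n) {r ρ : ℝ} (hr : 1 ≤ r)
    (hrρ : r < ρ) (hgen : ∀ n z, ‖z‖ = ρ → P n z ≠ 0) {m : ℕ} (hm : 1 ≤ m) {K : ℝ}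
    (hK : ∀ᶠ n in atTop, (absTail (P n) m r).toReal ≤ K * k n) :
    ∀ᶠ n in atTop, circleAverage (fun z => |log ‖P n z‖|) 0 ρ ≤ (c + 1) * k n := by
  have hρ0 : 0 < ρ := by linarith
  set S : ℕ → ℝ := fun n => √(circleAverage (fun z => log ‖P n z‖ ^ 2) 0 ρ) with hS
  set W : ℕ → ℝ := fun n => max (S n) (k n) with hW
  have hWk : ∀ n, k n ≤ W n := fun n => le_max_right _ _
  have hWS : ∀ n, S n ≤ W n := fun n => le_max_left _ _
  have hW0 : ∀ n, 0 < W n := fun n => (hk n).trans_le (hWk n)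
  have hcont : ∀ n, ContinuousOn (fun z => log ‖P n z‖) (sphere 0 ρ) := fun n =>
    continuousOn_log_norm (hP n).entire (hgen n)
  set v : ℕ → ℂ → ℝ := fun n z => (W n)⁻¹ * max (log ‖P n z‖) 0 with hv
  have hvcont : ∀ n, ContinuousOn (v n) (sphere 0 ρ) := fun n =>
    continuousOn_const.mul ((hcont n).sup continuousOn_const)
  have hv0 : ∀ n z, 0 ≤ v n z := fun n z =>
    mul_nonneg (inv_nonneg.2 (hW0 n).le) (le_max_right _ _)
  have hsq : ∀ n, circleAverage (fun z => v n z ^ 2) 0 ρ ≤ 1 := by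
    intro n
    have hpt : ∀ z, v n z ^ 2 ≤ ((W n) ^ 2)⁻¹ • log ‖P n z‖ ^ 2 := by
      intro z
      rw [hv, mul_pow, smul_eq_mul, inv_pow]
      refine mul_le_mul_of_nonneg_left ?_ (inv_nonneg.2 (sq_nonneg _))
      rcases le_total 0 (log ‖P n z‖) with h | h
      · rw [max_eq_left h]
      · rw [max_eq_right h, zero_pow two_ne_zero]; positivity
    have h2 : ContinuousOn (fun z => ((W n) ^ 2)⁻¹ • log ‖P n z‖ ^ 2) (sphere 0 ρ) := by
      have := hcont n
      fun_prop
    have h1 := circleAverage_mono (((hvcont n).pow 2).circleIntegrable hρ0.le)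
      (h2.circleIntegrable hρ0.le) fun z _ => hpt z
    refine h1.trans ?_
    rw [circleAverage_fun_smul, smul_eq_mul, inv_mul_le_iff₀ (pow_pos (hW0 n) 2),
      mul_one]
    exact (sqrt_le_left (hW0 n).le).1 (hWS n)
  have hlim : ∀ z, Tendsto (fun n => v n z) atTop (𝓝 0) := by
    intro z
    rw [Metric.tendsto_nhds]
    intro ε hε
    filter_upwards [hup z (ε / 2) (by positivity)] with n hn
    rw [dist_zero_right, norm_of_nonneg (hv0 n z)]
    have h1 : max (log ‖P n z‖) 0 ≤ ε / 2 * W n := by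
      refine max_le (hn.trans ?_) (by have := hW0 n; positivity)
      have := hWk n
      gcongr
    have h2 : v n z ≤ ε / 2 := by
      rw [hv]
      rw [inv_mul_le_iff₀ (hW0 n), mul_comm]
      exact h1
    linarith
  have hδ := tendsto_circleAverage_zero_of_sq_le hρ0 hvcont hv0 hsq hlim
  -- `δ n` is the `L¹` norm of the normalised positive part.
  set δ : ℕ → ℝ := fun n => circleAverage (v n) 0 ρ with hδdef
  have hpos : ∀ n, circleAverage (fun z => max (log ‖P n z‖) 0) 0 ρ = δ n * W n := by
    intro n
    rw [hδdef]
    simp only [hv]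
    simp_rw [← smul_eq_mul ((W n)⁻¹)]
    rw [circleAverage_fun_smul, smul_eq_mul, inv_mul_eq_div, div_mul_cancel₀ _ (hW0 n).ne']
  set A : ℝ := 1 + 2 * m + 2 / log (ρ / r) with hA
  set B : ℝ := 2 * c / log (ρ / r) + 4 * ρ ^ m * K with hB
  have hA0 : 0 < A := by
    have := log_pos ((one_lt_div (by linarith : 0 < r)).2 hrρ)
    positivity
  set M : ℝ := 1 + 2 * |A * c + B| with hM
  have hM0 : 0 < M := by positivity
  have hδ1 : ∀ᶠ n in atTop, δ n < 1 / (4 * A) := hδ.eventually_lt_const (by positivity)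
  have hδ2 : ∀ᶠ n in atTop, δ n < 1 / (2 * M) := hδ.eventually_lt_const (by positivity)
  -- The first bound on `δ n` absorbs the `L¹` norm into half of `W n`; this gives `W n ≤ M * k n`,
  -- and the second then makes the positive part small compared with `k n`.
  filter_upwards [hc, hK, hδ1, hδ2] with n hcn hKn h1 h2
  set a := circleAverage (fun z => |log ‖P n z‖|) 0 ρ with ha
  have hkn := hk n
  have hWn := hW0 n
  have ha1 : a ≤ 2 * (δ n * W n) + c * k n := by
    rw [ha, circleAverage_abs_log (hP n).entire, hpos n]
    have := circleMean_mono (hP n).entire (hP n).ne_zero (hr.trans hrρ.le)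
    linarith
  have hSn : S n ≤ A * a + B * k n :=
    (hP n).sqrt_circleAverage_sq_le hr hrρ (hgen n) hm hcn hKn
  have h3 : A * (2 * (δ n * W n)) ≤ W n / 2 := by
    rw [lt_div_iff₀ (by positivity)] at h1
    nlinarith
  have h4 : S n ≤ W n / 2 + (A * c + B) * k n := by
    have := mul_le_mul_of_nonneg_left ha1 hA0.le
    linarith
  have h5 : W n ≤ M * k n := by
    have h6 := mul_le_mul_of_nonneg_right (le_abs_self (A * c + B)) hkn.le
    have h7 : 0 ≤ |A * c + B| * k n := by positivity
    rcases le_total (S n) (k n) with h | h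
    · have : W n = k n := max_eq_right h
      rw [this, hM]; linarith
    · have : W n = S n := max_eq_left h
      rw [this] at h4 ⊢
      rw [hM]; linarith
  have h8 : 2 * (δ n * W n) ≤ k n := by
    have hδ0 : 0 ≤ δ n := circleAverage_nonneg_of_nonneg fun z _ => hv0 n z
    have := mul_le_mul_of_nonneg_left h5 hδ0
    rw [lt_div_iff₀ (by positivity)] at h2
    nlinarith
  linarith

/-- The bound does not depend on `R`: Jensen's formula is applied between `R` and a radius larger by
the factor `e`, on which the `L¹` norm obeys the same bound as on every other circle. -/
lemma eventually_zeroNum_le {P : ℕ → ℂ → ℂ} {k : ℕ → ℝ} (hP : ∀ n, IsGenusZero (P n))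
    (hk : ∀ n, 0 < k n) {c : ℝ} (hc : ∀ᶠ n in atTop, -(c * k n) ≤ circleMean (P n) 1)
    (hup : ∀ z : ℂ, ∀ ε > 0, ∀ᶠ n in atTop, log ‖P n z‖ ≤ ε * k n) {r : ℝ} (hr : 1 ≤ r)
    {m : ℕ} (hm : 1 ≤ m) {K : ℝ}
    (hK : ∀ᶠ n in atTop, (absTail (P n) m r).toReal ≤ K * k n) (R : ℝ) :
    ∀ᶠ n in atTop, zeroNum (P n) R ≤ (2 * c + 1) * k n := by
  set s := max r R with hs
  have hsr : r ≤ s := le_max_left _ _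
  obtain ⟨ρ, hρ, -, hgen⟩ := exists_radius_avoiding_zeros (fun n => (hP n).entire)
    (fun n => (hP n).ne_zero) (show s * exp 1 < s * exp 1 + 1 by linarith)
  have hs0 : 0 < s := by linarith
  have he : 1 ≤ exp 1 := one_le_exp zero_le_one
  have hsρ : s < ρ := lt_of_le_of_lt (le_mul_of_one_le_right hs0.le he) hρ
  have hlog : 1 ≤ log (ρ / s) := by
    rw [le_log_iff_exp_le (div_pos (hs0.trans hsρ) hs0), le_div_iff₀ hs0, mul_comm]
    exact hρ.le
  filter_upwards [hc, eventually_circleAverage_abs_le hP hk hc hup hr (hsr.trans_lt hsρ) hgen hm hK]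
    with n h1 h2
  have h3 := zeroNum_mul_log_le (hP n).entire (hP n).ne_zero (hr.trans hsr) hsρ.le
  have h4 : |circleMean (P n) ρ| ≤ circleAverage (fun z => |log ‖P n z‖|) 0 ρ :=
    abs_circleAverage_le_circleAverage_abs
  have h5 := le_abs_self (circleMean (P n) ρ)
  have h6 : zeroNum (P n) R ≤ zeroNum (P n) s :=
    zeroNum_mono (hP n).entire (hP n).ne_zero (le_max_right r R)
  have h7 := le_mul_of_one_le_right (zeroNum_nonneg (P n) s) hlog
  linarith

/-- The radius `2 * s` need not avoid the zeros. The Fourier coefficients are taken on a circle with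
radius between `s` and `2 * s` that avoids the zeros of all the functions; the terms between the two
radii are bounded by the number of zeros. -/
lemma eventually_norm_signedTail_le {P : ℕ → ℂ → ℂ} {k : ℕ → ℝ} (hP : ∀ n, IsGenusZero (P n))
    (hk : ∀ n, 0 < k n) {c : ℝ} (hc : ∀ᶠ n in atTop, -(c * k n) ≤ circleMean (P n) 1)
    (hup : ∀ z : ℂ, ∀ ε > 0, ∀ᶠ n in atTop, log ‖P n z‖ ≤ ε * k n) {r : ℝ} (hr : 1 ≤ r)
    {m : ℕ} (hm : 1 ≤ m) {K : ℝ}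
    (hK : ∀ᶠ n in atTop, (absTail (P n) m r).toReal ≤ K * k n) {l : ℕ} (hl : 1 ≤ l) {s : ℝ}
    (hs : r ≤ s) :
    ∀ᶠ n in atTop, ‖signedTail (P n) l (2 * s)‖ / k n ≤
      (2 * l * (c + 1) + 2 * (2 * c + 1)) / s ^ l := by
  have hs0 : 0 < s := by linarith
  obtain ⟨ρ, hρ, hρ2, hgen⟩ := exists_radius_avoiding_zeros (fun n => (hP n).entire)
    (fun n => (hP n).ne_zero) (show s < 2 * s by linarith)
  have hρ0 : 0 < ρ := hs0.trans hρ
  filter_upwards [eventually_circleAverage_abs_le hP hk hc hup hr (hs.trans_lt hρ) hgen hm hK,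
    eventually_zeroNum_le hP hk hc hup hr hm hK (2 * s)] with n h1 h2
  have hkn := hk n
  have h3 := (hP n).norm_signedTail_le_add hl hρ0 hρ2.le
  have h4 := (hP n).pow_mul_norm_signedTail_le hρ0 (hgen n) hl
  have h5 := (norm_circleCoeff_le (u := fun z => log ‖P n z‖) hρ0 l).trans h1
  have h6 := zeroNum_mono (hP n).entire (hP n).ne_zero hρ2.le
  have h7 : ρ ^ l * ‖signedTail (P n) l (2 * s)‖ ≤
      (2 * l * (c + 1) + 2 * (2 * c + 1)) * k n := by
    have h8 := mul_le_mul_of_nonneg_left h3 (show 0 ≤ ρ ^ l by positivity)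
    rw [mul_add, mul_div_cancel₀ _ (by positivity)] at h8
    have h9 := mul_le_mul_of_nonneg_left h5 (show 0 ≤ 2 * (l : ℝ) by positivity)
    linarith
  rw [div_le_div_iff₀ hkn (by positivity), mul_comm]
  refine le_trans ?_ h7
  gcongr

/-! ### From the limit superior and inferior to eventual bounds -/

lemma logMean_eq_exp_circleMean (f : ℂ → ℂ) (R : ℝ) : logMean f R = exp (circleMean f R) := by
  simp only [logMean, circleMean, circleAverage, circleMap, zero_add, one_div, smul_eq_mul]

lemma exists_circleMean_ge {P : ℕ → ℂ → ℂ} {k : ℕ → ℝ} (hk : ∀ n, 0 < k n)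
    (hC : 0 < lowerConst P k) :
    ∃ c : ℝ, 0 ≤ c ∧ ∀ᶠ n in atTop, -(c * k n) ≤ circleMean (P n) 1 := by
  obtain ⟨a, ha0, ha⟩ := ENNReal.lt_iff_exists_nnreal_btwn.1 hC
  have ha0' : (0 : ℝ) < a := by exact_mod_cast ha0
  refine ⟨max 0 (-log a), le_max_left _ _, ?_⟩
  filter_upwards [eventually_lt_of_lt_liminf ha] with n hn
  have hkn := hk n
  rw [logMean_eq_exp_circleMean, ← exp_mul, ← ENNReal.ofReal_coe_nnreal,
    ENNReal.ofReal_lt_ofReal_iff (exp_pos _)] at hn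
  have h1 : log a < circleMean (P n) 1 / k n := by
    have := log_lt_log ha0' hn
    rwa [log_exp, mul_one_div] at this
  rw [lt_div_iff₀ hkn] at h1
  have h2 := mul_le_mul_of_nonneg_right (le_max_right 0 (-log a)) hkn.le
  linarith

lemma eventually_log_norm_le {P : ℕ → ℂ → ℂ} {k : ℕ → ℝ} (hk : ∀ n, 0 < k n) {z : ℂ}
    (h : limsup (fun n => ENNReal.ofReal (‖P n z‖ ^ (1 / k n))) atTop ≤ 1) {ε : ℝ} (hε : 0 < ε) :
    ∀ᶠ n in atTop, log ‖P n z‖ ≤ ε * k n := by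
  have h1 : limsup (fun n => ENNReal.ofReal (‖P n z‖ ^ (1 / k n))) atTop <
      ENNReal.ofReal (exp ε) := h.trans_lt (by
        rw [← ENNReal.ofReal_one, ENNReal.ofReal_lt_ofReal_iff (exp_pos _)]
        exact one_lt_exp_iff.2 hε)
  filter_upwards [eventually_lt_of_limsup_lt h1] with n hn
  have hkn := hk n
  rw [ENNReal.ofReal_lt_ofReal_iff (exp_pos _)] at hn
  -- At a zero of `P n` the logarithm has the value `0`, which obeys the bound.
  rcases eq_or_ne (P n z) 0 with h0 | h0
  · rw [h0, norm_zero, log_zero]; positivity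
  · have hpos := norm_pos_iff.2 h0
    have := log_lt_log (by positivity) hn
    rw [log_exp, log_rpow hpos, one_div_mul_eq_div, div_lt_iff₀ hkn] at this
    exact this.le

lemma exists_absTail_le_of_limsup_lt_top {P : ℕ → ℂ → ℂ} {k : ℕ → ℝ} (hk : ∀ n, 0 < k n)
    {m : ℕ} {R : ℝ} (h : absTailLimsup P k m R < ⊤) :
    ∃ K : ℝ, ∀ᶠ n in atTop, (absTail (P n) m R).toReal ≤ K * k n := by
  obtain ⟨K, hK, -⟩ := ENNReal.lt_iff_exists_nnreal_btwn.1 h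
  refine ⟨K, ?_⟩
  filter_upwards [eventually_lt_of_limsup_lt hK] with n hn
  have hkn := hk n
  have h0 : ENNReal.ofReal (k n) ≠ 0 := by simpa using hkn
  rw [ENNReal.div_lt_iff (Or.inl h0) (Or.inl ENNReal.ofReal_ne_top)] at hn
  have := ENNReal.toReal_mono (ENNReal.mul_ne_top ENNReal.coe_ne_top ENNReal.ofReal_ne_top) hn.le
  rwa [ENNReal.toReal_mul, ENNReal.coe_toReal, ENNReal.toReal_ofReal hkn.le] at this

/-! ### Limits of the tails and of the counting function -/

lemma absTailLimsup_antitone (P : ℕ → ℂ → ℂ) (k : ℕ → ℝ) (m : ℕ) :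
    Antitone (absTailLimsup P k m) := fun _ _ h =>
  limsup_le_limsup (Eventually.of_forall fun n => ENNReal.div_le_div_right
    (absTail_antitone (P n) m h) _)

lemma absTail_succ_le (f : ℂ → ℂ) (m : ℕ) {R : ℝ} (hR : 0 < R) :
    absTail f (m + 1) R ≤ ENNReal.ofReal R⁻¹ * absTail f m R := by
  unfold absTail
  rw [← ENNReal.tsum_mul_left]
  refine ENNReal.tsum_le_tsum fun w => ?_
  rw [← ENNReal.ofReal_mul (by positivity)]
  refine ENNReal.ofReal_le_ofReal ?_
  have hw : 0 < ‖(w : ℂ)‖ := hR.trans_le w.2.2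
  rw [pow_succ', ← div_div, div_right_comm, div_eq_inv_mul _ ‖(w : ℂ)‖]
  gcongr
  exact w.2.2

lemma absTailLimsup_succ_le (P : ℕ → ℂ → ℂ) (k : ℕ → ℝ) (m : ℕ) {R : ℝ} (hR : 0 < R) :
    absTailLimsup P k (m + 1) R ≤ ENNReal.ofReal R⁻¹ * absTailLimsup P k m R := by
  unfold absTailLimsup
  rw [← ENNReal.limsup_const_mul_of_ne_top ENNReal.ofReal_ne_top]
  refine limsup_le_limsup (Eventually.of_forall fun n => ?_)
  simp only [← mul_div_assoc]
  exact ENNReal.div_le_div_right (absTail_succ_le (P n) m hR) _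

lemma tendsto_absTailLimsup_succ {P : ℕ → ℂ → ℂ} {k : ℕ → ℝ} {m : ℕ} {R : ℝ}
    (h : absTailLimsup P k m R < ⊤) :
    Tendsto (absTailLimsup P k (m + 1)) atTop (𝓝 0) := by
  have hlim : Tendsto (fun s : ℝ => ENNReal.ofReal s⁻¹ * absTailLimsup P k m R) atTop (𝓝 0) := by
    have h1 : Tendsto (fun s : ℝ => ENNReal.ofReal s⁻¹) atTop (𝓝 0) := by
      simpa using ENNReal.tendsto_ofReal tendsto_inv_atTop_zero
    simpa using ENNReal.Tendsto.mul_const h1 (Or.inr h.ne)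
  refine tendsto_of_tendsto_of_tendsto_of_le_of_le' tendsto_const_nhds hlim
    (Eventually.of_forall fun _ => zero_le) ?_
  filter_upwards [eventually_ge_atTop R, eventually_gt_atTop 0] with s hs hs0
  refine (absTailLimsup_succ_le P k m hs0).trans ?_
  gcongr
  exact absTailLimsup_antitone P k m hs

lemma tendsto_signedTailLimsup {P : ℕ → ℂ → ℂ} {k : ℕ → ℝ} (hP : ∀ n, IsGenusZero (P n))
    (hk : ∀ n, 0 < k n) (hC : 0 < lowerConst P k)
    (hgrowth : ∀ z : ℂ, limsup (fun n => ENNReal.ofReal (‖P n z‖ ^ (1 / k n))) atTop ≤ 1)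
    {m : ℕ} (hm : 1 ≤ m) {r : ℝ} (hr : 1 ≤ r) (h : absTailLimsup P k m r < ⊤) {l : ℕ}
    (hl : 1 ≤ l) : Tendsto (signedTailLimsup P k l) atTop (𝓝 0) := by
  obtain ⟨c, hc0, hc⟩ := exists_circleMean_ge hk hC
  obtain ⟨K, hK⟩ := exists_absTail_le_of_limsup_lt_top hk h
  set D : ℝ := 2 * l * (c + 1) + 2 * (2 * c + 1) with hD
  have hlim : Tendsto (fun R : ℝ => ENNReal.ofReal (D / (R / 2) ^ l)) atTop (𝓝 0) := by
    have h1 : Tendsto (fun R : ℝ => D / (R / 2) ^ l) atTop (𝓝 0) :=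
      ((tendsto_pow_atTop (by omega)).comp
        (tendsto_id.atTop_div_const (two_pos (α := ℝ)))).const_div_atTop D
    simpa using ENNReal.tendsto_ofReal h1
  refine tendsto_of_tendsto_of_tendsto_of_le_of_le' tendsto_const_nhds hlim
    (Eventually.of_forall fun _ => zero_le) ?_
  filter_upwards [eventually_ge_atTop (2 * r)] with R hR
  refine limsup_le_of_le (h := ?_)
  have := eventually_norm_signedTail_le hP hk hc
    (fun z ε hε => eventually_log_norm_le hk (hgrowth z) hε) hr hm hK hl
    (show r ≤ R / 2 by linarith)
  filter_upwards [this] with n hn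
  rw [mul_div_cancel₀ R two_ne_zero] at hn
  exact ENNReal.ofReal_le_ofReal hn

lemma absTail_one_two_le_degree (f : ℂ → ℂ) : absTail f 1 2 ≤ degree f := by
  have h : absTail f 1 2 ≤
      ∑' w : {w : ℂ // 1 < ‖w‖}, ENNReal.ofReal ((mult f w : ℝ) / ‖(w : ℂ)‖) := by
    have e : ∑' w : {w : ℂ // 1 < ‖w‖}, ENNReal.ofReal ((mult f w : ℝ) / ‖(w : ℂ)‖) =
        ∑' w : ℂ, {w : ℂ | 1 < ‖w‖}.indicator
          (fun w => ENNReal.ofReal ((mult f w : ℝ) / ‖w‖)) w :=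
      tsum_subtype {w : ℂ | 1 < ‖w‖} fun w => ENNReal.ofReal ((mult f w : ℝ) / ‖w‖)
    rw [e, absTail_eq_tsum_indicator]
    simp only [pow_one]
    have hsub : {w : ℂ | w ≠ 0 ∧ 2 ≤ ‖w‖} ⊆ {w : ℂ | 1 < ‖w‖} :=
      fun w hw => one_lt_two.trans_le hw.2
    exact ENNReal.tsum_le_tsum fun w =>
      Set.indicator_le_indicator_of_subset hsub (fun _ => zero_le) w
  exact h.trans le_add_self

lemma zeroCount_le {f : ℂ → ℂ} (hf : Differentiable ℂ f) (h0 : f ≠ 0) (R : ℝ) :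
    zeroCount f R ≤ ENNReal.ofReal (zeroNum f R) := by
  have e : zeroCount f R = ∑' w : ℂ, {w : ℂ | 0 < ‖w‖ ∧ ‖w‖ ≤ R}.indicator
      (fun w => (mult f w : ℝ≥0∞)) w :=
    tsum_subtype {w : ℂ | 0 < ‖w‖ ∧ ‖w‖ ≤ R} fun w => (mult f w : ℝ≥0∞)
  rw [ofReal_zeroNum, e, tsum_eq_sum (s := zeroFinset f R)]
  · exact Finset.sum_le_sum fun w _ => Set.indicator_apply_le' (fun _ => le_rfl) fun _ => zero_le
  · intro w hw
    by_cases h : w ∈ {w : ℂ | 0 < ‖w‖ ∧ ‖w‖ ≤ R}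
    · have : mult f w = 0 := by
        by_contra hm
        exact hw ((mem_zeroFinset hf h0).2 ⟨h.2, (mult_ne_zero_iff hf h0 w).1 hm⟩)
      rw [Set.indicator_of_mem h, this, Nat.cast_zero]
    · exact Set.indicator_of_notMem h _

/-- A diagonal argument: if each `a j` is eventually true, then `a (j n) n` is
eventually true for some sequence `j` tending to infinity. -/
lemma exists_tendsto_atTop_eventually {a : ℕ → ℕ → Prop} (h : ∀ j, ∀ᶠ n in atTop, a j n) :
    ∃ j : ℕ → ℕ, Tendsto j atTop atTop ∧ ∀ᶠ n in atTop, a (j n) n := by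
  classical
  have hp : ∀ j, ∀ᶠ n in atTop, ∀ i ≥ n, a j i := fun j => by
    obtain ⟨N, hN⟩ := eventually_atTop.1 (h j)
    filter_upwards [eventually_ge_atTop N] with n hn i hi using hN i (hn.trans hi)
  refine ⟨fun n => Nat.findGreatest (fun j => ∀ i ≥ n, a j i) n, ?_, ?_⟩
  · refine tendsto_atTop.2 fun j => ?_
    filter_upwards [hp j, eventually_ge_atTop j] with n hn hj
    exact Nat.le_findGreatest hj hn
  · filter_upwards [hp 0] with n hn
    exact Nat.findGreatest_spec (P := fun j => ∀ i ≥ n, a j i) (Nat.zero_le n) hn n le_rfl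

lemma exists_radii_zeroCount_le {P : ℕ → ℂ → ℂ} {k : ℕ → ℝ} (hP : ∀ n, IsGenusZero (P n))
    (hk : ∀ n, 0 < k n) (hC : 0 < lowerConst P k)
    (hgrowth : ∀ z : ℂ, limsup (fun n => ENNReal.ofReal (‖P n z‖ ^ (1 / k n))) atTop ≤ 1)
    {m : ℕ} (hm : 1 ≤ m) {s : ℝ} (hs : 1 ≤ s) (h : absTailLimsup P k m s < ⊤) :
    ∃ r : ℕ → ℝ, (∀ n, 0 < r n) ∧ Tendsto r atTop atTop ∧
      limsup (fun n => zeroCount (P n) (r n) / ENNReal.ofReal (k n)) atTop < ⊤ := by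
  obtain ⟨c, hc0, hc⟩ := exists_circleMean_ge hk hC
  obtain ⟨K, hK⟩ := exists_absTail_le_of_limsup_lt_top hk h
  obtain ⟨j, hj, hj'⟩ := exists_tendsto_atTop_eventually
    (a := fun j n => zeroNum (P n) (j + 1) ≤ (2 * c + 1) * k n) fun j =>
      eventually_zeroNum_le hP hk hc (fun z ε hε => eventually_log_norm_le hk (hgrowth z) hε)
        hs hm hK (j + 1)
  refine ⟨fun n => j n + 1, fun n => by positivity,
    tendsto_atTop_add_const_right _ _ (tendsto_natCast_atTop_atTop.comp hj), ?_⟩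
  refine lt_of_le_of_lt (limsup_le_of_le (a := ENNReal.ofReal (2 * c + 1)) (h := ?_))
    ENNReal.ofReal_lt_top
  filter_upwards [hj'] with n hn
  refine ENNReal.div_le_of_le_mul ?_
  rw [← ENNReal.ofReal_mul (by positivity)]
  exact (zeroCount_le (hP n).entire (hP n).ne_zero _).trans (ENNReal.ofReal_le_ofReal hn)

end GenusZero

end

theorem mainTheorem1 (P : ℕ → ℂ → ℂ) (k : ℕ → ℝ)
    (hP : ∀ n, GenusZero.IsGenusZero (P n))
    (hk : ∀ n, 0 < k n)
    (hC : 0 < GenusZero.lowerConst P k)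
    (hgrowth : ∀ z : ℂ,
      limsup (fun n => ENNReal.ofReal (‖P n z‖ ^ (1 / k n))) atTop ≤ 1) :
    -- all the sums over zeros converge absolutely
    (∀ (n m : ℕ) (R : ℝ), 1 ≤ m → GenusZero.absTail (P n) m R < ⊤) ∧
    -- exactly one of the two alternatives holds
    Xor
      (∀ m : ℕ, 1 ≤ m → Tendsto (GenusZero.absTailLimsup P k m) atTop (𝓝 ⊤))
      ((∃ m : ℕ, 1 ≤ m ∧ Tendsto (GenusZero.absTailLimsup P k m) atTop (𝓝 0)) ∧
        ∀ l : ℕ, 1 ≤ l → Tendsto (GenusZero.signedTailLimsup P k l) atTop (𝓝 0)) ∧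
    -- the moreover part: one vanishing absolute tail makes all the signed tails vanish
    (∀ m : ℕ, 1 ≤ m → Tendsto (GenusZero.absTailLimsup P k m) atTop (𝓝 0) →
      ∀ l : ℕ, 1 ≤ l → Tendsto (GenusZero.signedTailLimsup P k l) atTop (𝓝 0)) ∧
    -- the case `k_n ≥ d^*(P_n)`
    ((∀ n, GenusZero.degree (P n) ≤ ENNReal.ofReal (k n)) →
      (∃ m : ℕ, 1 ≤ m ∧ Tendsto (GenusZero.absTailLimsup P k m) atTop (𝓝 0)) ∧
      (∀ l : ℕ, 1 ≤ l → Tendsto (GenusZero.signedTailLimsup P k l) atTop (𝓝 0)) ∧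
      Tendsto (GenusZero.signedTailLimsup P k 1) atTop (𝓝 0) ∧
      ∃ r : ℕ → ℝ, (∀ n, 0 < r n) ∧ Tendsto r atTop atTop ∧
        limsup (fun n => GenusZero.zeroCount (P n) (r n) / ENNReal.ofReal (k n)) atTop < ⊤) := by
  have htail : ∀ m : ℕ, 1 ≤ m → ∀ R : ℝ, GenusZero.absTailLimsup P k m R < ⊤ →
      ∀ l : ℕ, 1 ≤ l → Tendsto (GenusZero.signedTailLimsup P k l) atTop (𝓝 0) :=
    fun m hm R h l hl => GenusZero.tendsto_signedTailLimsup hP hk hC hgrowth hm (le_max_right R 1)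
      ((GenusZero.absTailLimsup_antitone P k m (le_max_left R 1)).trans_lt h) hl
  have hmore : ∀ m : ℕ, 1 ≤ m → Tendsto (GenusZero.absTailLimsup P k m) atTop (𝓝 0) →
      ∀ l : ℕ, 1 ≤ l → Tendsto (GenusZero.signedTailLimsup P k l) atTop (𝓝 0) := by
    intro m hm h
    obtain ⟨R, hR⟩ := (h.eventually_lt_const ENNReal.zero_lt_top).exists
    exact htail m hm R hR
  refine ⟨fun n m R hm => (hP n).absTail_lt_top hm R, ?_, hmore, fun hdeg => ?_⟩
  · by_cases h : ∃ m : ℕ, 1 ≤ m ∧ ∃ R : ℝ, GenusZero.absTailLimsup P k m R < ⊤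
    · obtain ⟨m, hm, R, hR⟩ := h
      refine Or.inr ⟨⟨⟨m + 1, by omega, GenusZero.tendsto_absTailLimsup_succ hR⟩,
        htail m hm R hR⟩, fun htop => ?_⟩
      exact ENNReal.zero_ne_top
        (tendsto_nhds_unique (GenusZero.tendsto_absTailLimsup_succ hR) (htop (m + 1) (by omega)))
    · push Not at h
      have htop : ∀ m : ℕ, 1 ≤ m → Tendsto (GenusZero.absTailLimsup P k m) atTop (𝓝 ⊤) :=
        fun m hm => tendsto_const_nhds.congr fun R => (top_le_iff.1 (h m hm R)).symm
      refine Or.inl ⟨htop, fun ⟨⟨m, hm, h0⟩, _⟩ => ?_⟩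
      exact ENNReal.zero_ne_top (tendsto_nhds_unique h0 (htop m hm))
  · have h2 : GenusZero.absTailLimsup P k 1 2 < ⊤ := by
      refine lt_of_le_of_lt (limsup_le_of_le (a := 1) (h := ?_)) ENNReal.one_lt_top
      refine Eventually.of_forall fun n => ENNReal.div_le_of_le_mul ?_
      rw [one_mul]
      exact (GenusZero.absTail_one_two_le_degree (P n)).trans (hdeg n)
    refine ⟨⟨2, one_le_two, GenusZero.tendsto_absTailLimsup_succ h2⟩, htail 1 le_rfl 2 h2,
      htail 1 le_rfl 2 h2 1 le_rfl, ?_⟩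
    exact GenusZero.exists_radii_zeroCount_le hP hk hC hgrowth le_rfl one_le_two h2
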